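/- **Setting.** Let $\mathcal X'=\{x\in\mathbb R^d:\|x\|\le R\}$ (Euclidean norm), let $f:\mathcal X'\to\mathbb R$ be convex and $G$-Lipschitz with $G>0$, and let $\mathcal X\subseteq\mathcal X'$ be convex with diameter $D_{\mathcal X}$, accessed through a linear minimization oracle, i.e. a (measurable) map $g\mapsto \mathrm{LMO}(g)\in\operatorname{argmin}_{s\in\mathcal X}\langle g,s\rangle$. The function $f$ is accessed through a stochastic first-order oracle (SFO) of variance $\sigma^2$: queried at a (random) point $u\in\mathcal X'$ it returns a random vector $\hat g$ with $\mathbb E[\hat g\mid u]=g$ and $\mathbb E[\|\hat g-g\|^2\mid u]\le\sigma^2$ for some $g\in\partial f(u)$ with $\|g\|\le G$. (More generally, one may condition on any information with respect to which $u$ and $g$ are measurable, e.g. the whole past; $\sigma=0$ includes a deterministic oracle.) Let $x_0\in\mathcal X$, $x^*\in\operatorname{argmin}_{x\in\mathcal X}f(x)$ and $\varepsilon>0$. **MOLES**, with inputs $\lambda$, $\tilde D$, $c'$, $K$. Set $x_0'=z_0'=z_0=x_0$. For $k=1,\dots,K$ put $$\beta_k=\tfrac{4}{\lambda k},\quad \gamma_k=\tfrac{2}{k+1},\quad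 T_k=\Big\lceil\tfrac{(4G^2+\sigma^2)\lambda^2Kk^2}{2\tilde D}\Big\rceil,\quad \hat T=\Big\lceil \tfrac{7KD_{\mathcal X}^2}{c'\tilde D}\Big\rceil,\quad \eta_k=\tfrac{4c'\tilde D}{\lambda Kk},$$ $$(y_k,y_k')=(1-\gamma_k)(x_{k-1},x_{k-1}')+\gamma_k(z_{k-1},z_{k-1}').$$ * *Frank–Wolfe based projection.* Let $w=z_{k-1}-\frac1{\beta_k}\cdot\frac{y_k-y_k'}{\lambda}$ and $u_0=z_{k-1}$. For $t=1,\dots,\hat T$: call $s_t=\mathrm{LMO}(u_{t-1}-w)$; if the Wolfe gap satisfies $\beta_k\langle u_{t-1}-w,u_{t-1}-s_t\rangle\le\eta_k$, stop with $z_k=u_{t-1}$; otherwise set $u_t=\frac{(t-1)u_{t-1}+2s_t}{t+1}$. If the loop does not stop early, $z_k=u_{\hat T}$. * *Prox-Slide.* Let $u_0=\tilde u_0=z_{k-1}'$ and $g=\frac{y_k'-y_k}{\lambda}$. For $t=1,\dots,T_k$: let $\hat g_{t-1}$ be the answer of the SFO at $u_{t-1}$, let $u_t$ be the projection onto $\mathcal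 X'$ of $u_{t-1}-\frac{1}{(1+t/2)\beta_k}\big(\hat g_{t-1}+\beta_k(u_{t-1}-(u_0-g/\beta_k))\big)$, and $\tilde u_t=(1-\theta_t)\tilde u_{t-1}+\theta_tu_t$ with $\theta_t=\frac{2(t+1)}{t(t+3)}$. Put $z_k'=u_{T_k}$, $\tilde z_k'=\tilde u_{T_k}$. * Put $(x_k,x_k')=(1-\gamma_k)(x_{k-1},x_{k-1}')+\gamma_k(z_k,\tilde z_k')$. The output is $x_K$. **Theorem (MOLES guarantee).** For all absolute constants $c,c'>0$ there is a constant $C>0$ depending only on $c,c'$ such that, in the setting above (in every dimension), MOLES run with $$\lambda=\frac{\varepsilon}{G^2},\qquad \tilde D=c\,\|x_0-x^*\|^2,\qquad K=\Big\lceil\frac{2\sqrt{10+8c(1+c')}\;G\|x_0-x^*\|}{\varepsilon}\Big\rceil$$ outputs a feasible point $x_K\in\mathcal X$ with $$\mathbb E[f(x_K)]-\min_{x\in\mathcal X}f(x)\le\varepsilon .$$ Moreover, if $\varepsilon\le G\|x_0-x^*\|$, then $K\le C\,\frac{G\|x_0-x^*\|}{\varepsilon}$, and MOLES uses at most $C\,\frac{G^2D_{\mathcal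 X}^2}{\varepsilon^2}$ LMO calls and at most $C\,\frac{(G^2+\sigma^2)D_{\mathcal X}^2}{\varepsilon^2}$ SFO calls. -/

import Mathlib

open MeasureTheory

section MOLES

variable {E : Type*} [NormedAddCommGroup E] [InnerProductSpace ℝ E]

/-- `g` is a subgradient at `x` of the function `f` with domain `S`. -/
def IsSubgradientOn (f : E → ℝ) (S : Set E) (x g : E) : Prop :=
  ∀ y ∈ S, f x + inner ℝ g (y - x) ≤ f y

/-- `lmo` is a linear minimization oracle for `X`: `lmo g ∈ argmin_{s ∈ X} ⟪g, s⟫`. -/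
def IsLMO (X : Set E) (lmo : E → E) : Prop :=
  ∀ g, lmo g ∈ X ∧ ∀ s ∈ X, inner ℝ g (lmo g) ≤ inner ℝ g s

/-- The random vector `ghat` is an answer of a stochastic first-order oracle of variance `σ ^ 2`
at the random query point `u`: conditionally on some information `m` that contains the query point
(the query point alone, or the whole past), `ghat` has mean `g` and variance at most `σ ^ 2`,
where `g` is a subgradient of `f : S → ℝ` at `u` of norm at most `G`. -/
def IsSFOAnswer {Ω : Type*} [mΩ : MeasurableSpace Ω] (μ : Measure Ω) (f : E → ℝ) (S : Set E)
    (G σ : ℝ) [MeasurableSpace E] [CompleteSpace E] (u ghat : Ω → E) : Prop :=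
  Measurable ghat ∧ MemLp ghat 2 μ ∧
    ∃ (m : MeasurableSpace Ω) (g : Ω → E), m ≤ mΩ ∧ Measurable[m] u ∧ StronglyMeasurable[m] g ∧
      (∀ᵐ ω ∂μ, IsSubgradientOn f S (u ω) (g ω) ∧ ‖g ω‖ ≤ G) ∧
      μ[ghat | m] =ᵐ[μ] g ∧
      μ[fun ω => ‖ghat ω - g ω‖ ^ 2 | m] ≤ᵐ[μ] fun _ => σ ^ 2

/-- Frank-Wolfe for `min_{u ∈ X} (β / 2) * ‖u - z‖ ^ 2`: at most `n` further steps, numbered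
`t, t + 1, …`, from the current iterate `u`. Each step makes one LMO call, with answer `s`; it
stops at the current iterate if its Wolfe gap `β * ⟪u - z, u - s⟫` is at most the tolerance `η`, and
otherwise moves to `((t - 1) * u + 2 * s) / (t + 1)`. Returned are the final iterate and the number
of LMO calls made. -/
noncomputable def fwProjection (lmo : E → E) (z : E) (β η : ℝ) : ℕ → ℕ → E → E × ℕ
  | 0, _, u => (u, 0)
  | n + 1, t, u =>
    let s := lmo (u - z)
    if β * inner ℝ (u - z) (u - s) ≤ η then (u, 1)
    else
      let r := fwProjection lmo z β η n (t + 1)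
        ((1 / ((t : ℝ) + 1)) • (((t : ℝ) - 1) • u + (2 : ℝ) • s))
      (r.1, r.2 + 1)

/-- State of the Prox-Slide loop: the iterate, the weighted average of the iterates, and the number
of stochastic first-order oracle calls made so far. -/
structure ProxSlideState (E : Type*) where
  u : E
  avg : E
  sfoCalls : ℕ

/-- The projection of `v` onto the closed ball of radius `R` around the origin. -/
noncomputable def projBall (R : ℝ) (v : E) : E := min 1 (R / ‖v‖) • v

/-- The Prox-Slide procedure with inputs `g, u₀, β`, after `t` steps. Step `t` makes one stochastic
first-order oracle call, at the iterate `u_{t-1}`, and receives the answer `ghat (t - 1)`. -/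
noncomputable def proxSlide (R : ℝ) (ghat : ℕ → E) (g u₀ : E) (β : ℝ) : ℕ → ProxSlideState E
  | 0 => ⟨u₀, u₀, 0⟩
  | n + 1 =>
    let S := proxSlide R ghat g u₀ β n
    let t : ℝ := (n : ℝ) + 1
    let θ : ℝ := 2 * (t + 1) / (t * (t + 3))
    let u := projBall R
      (S.u - (1 / ((1 + t / 2) * β)) • (ghat n + β • (S.u - (u₀ - (1 / β) • g))))
    ⟨u, (1 - θ) • S.avg + θ • u, S.sfoCalls + 1⟩

/-- The numerical inputs of MOLES: the radius `R` of the ball `X'`, the Lipschitz constant `G`, the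
noise level `σ`, the diameter `D` of `X`, the smoothing parameter `lam`, the parameters `Dtilde` and
`c'`, and the number `K` of outer iterations. -/
structure MolesParams where
  R : ℝ
  G : ℝ
  σ : ℝ
  D : ℝ
  lam : ℝ
  Dtilde : ℝ
  c' : ℝ
  K : ℕ

namespace MolesParams

/-- `β_k = 4 / (λ k)`. -/
noncomputable def β (P : MolesParams) (k : ℕ) : ℝ := 4 / (P.lam * k)

/-- `γ_k = 2 / (k + 1)`. -/
noncomputable def γ (_P : MolesParams) (k : ℕ) : ℝ := 2 / ((k : ℝ) + 1)

/-- The number of Prox-Slide steps in outer iteration `k`. -/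
noncomputable def T (P : MolesParams) (k : ℕ) : ℕ :=
  ⌈(4 * P.G ^ 2 + P.σ ^ 2) * P.lam ^ 2 * P.K * (k : ℝ) ^ 2 / (2 * P.Dtilde)⌉₊

/-- The maximal number of Frank-Wolfe steps in an outer iteration. -/
noncomputable def That (P : MolesParams) : ℕ := ⌈7 * P.K * P.D ^ 2 / (P.c' * P.Dtilde)⌉₊

/-- The tolerance for the Wolfe gap in outer iteration `k`. -/
noncomputable def η (P : MolesParams) (k : ℕ) : ℝ := 4 * P.c' * P.Dtilde / (P.lam * P.K * k)

end MolesParams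

/-- State of MOLES, together with the numbers of oracle calls made so far. -/
structure MolesState (E : Type*) where
  x : E
  x' : E
  z : E
  z' : E
  lmoCalls : ℕ
  sfoCalls : ℕ

namespace MolesState

/-- The extrapolation point `y_k`, computed from the state after outer iteration `k - 1`. -/
noncomputable def y (S : MolesState E) (P : MolesParams) (k : ℕ) : E :=
  (1 - P.γ k) • S.x + P.γ k • S.z

/-- The extrapolation point `y_k'`, computed from the state after outer iteration `k - 1`. -/
noncomputable def y' (S : MolesState E) (P : MolesParams) (k : ℕ) : E :=
  (1 - P.γ k) • S.x' + P.γ k • S.z'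

/-- The Frank-Wolfe based projection in outer iteration `k`: it starts at `z_{k-1}` and approximates
the projection onto `X` of `z_{k-1} - (1 / β_k) * (y_k - y_k') / λ`. -/
noncomputable def project (S : MolesState E) (P : MolesParams) (lmo : E → E) (k : ℕ) : E × ℕ :=
  fwProjection lmo (S.z - (1 / P.β k) • ((1 / P.lam) • (S.y P k - S.y' P k))) (P.β k) (P.η k)
    P.That 1 S.z

/-- The Prox-Slide procedure in outer iteration `k`, after `t` steps. -/
noncomputable def slide (S : MolesState E) (P : MolesParams) (ghat : ℕ → E) (k t : ℕ) :
    ProxSlideState E :=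
  proxSlide P.R ghat ((1 / P.lam) • (S.y' P k - S.y P k)) S.z' (P.β k) t

/-- Outer iteration `k` of MOLES. -/
noncomputable def step (S : MolesState E) (P : MolesParams) (lmo : E → E) (ghat : ℕ → E) (k : ℕ) :
    MolesState E :=
  let p := S.project P lmo k
  let q := S.slide P ghat k (P.T k)
  { x := (1 - P.γ k) • S.x + P.γ k • p.1
    x' := (1 - P.γ k) • S.x' + P.γ k • q.avg
    z := p.1
    z' := q.u
    lmoCalls := S.lmoCalls + p.2
    sfoCalls := S.sfoCalls + q.sfoCalls }

end MolesState

/-- The state of MOLES, started at `x₀`, after `k` outer iterations, where `ghat k t` is the answer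
to the call number `t` (counted from `0`) to the stochastic first-order oracle in outer
iteration `k`. -/
noncomputable def moles (P : MolesParams) (lmo : E → E) (x₀ : E) (ghat : ℕ → ℕ → E) :
    ℕ → MolesState E
  | 0 => ⟨x₀, x₀, x₀, x₀, 0, 0⟩
  | k + 1 => (moles P lmo x₀ ghat k).step P lmo (ghat (k + 1)) (k + 1)

/-- The point at which MOLES makes the call number `t` (counted from `0`) to the stochastic
first-order oracle in outer iteration `k + 1`. It depends only on the earlier answers. -/
noncomputable def molesQuery (P : MolesParams) (lmo : E → E) (x₀ : E) (ghat : ℕ → ℕ → E)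
    (k t : ℕ) : E :=
  ((moles P lmo x₀ ghat k).slide P (ghat (k + 1)) (k + 1) t).u

end MOLES

/-!
The nonsmooth problem `min_{x ∈ X} f x` is relaxed to the minimization of
`f x' + ‖x - x'‖ ^ 2 / (2 * lam)` over `x ∈ X` and `x'` in the ball (`penalized`). As `f` is
`G`-Lipschitz, replacing `x'` by `x` costs at most `lam * G ^ 2 / 2`, which is `ε / 2` for
`lam = ε / G ^ 2` (`le_penalized_add`); it remains to make the relaxed objective `ε / 2`-optimal.

MOLES is an accelerated proximal method for the relaxed objective that linearizes the quadratic
penalty only. The proximal problem splits into one in `x`, a projection onto `X`, and one in `x'`,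
which contains `f`.

* The projection is solved by Frank-Wolfe (`fwProjection_gap_le`). Some iterate has small Wolfe gap:
  after half of the steps the primal gap is of the order of one over their number, and if the Wolfe
  gap stayed large, the other half would push the primal gap below zero (`fw_wolfe_gap_false`).
* The problem in `x'` is solved by a stochastic subgradient method with exact proximal steps. With
  weight `t + 1` on step `t`, the distances to a comparison point telescope (`proxSlide_bound`).
* In the weighting `k * (k + 1)` the outer iterations telescope too (`moles_step_bound`,
  `moles_bound`).

All of this holds path by path, with an explicit error term that is a sum over the oracle answers.
Each summand is a square, of controlled mean, minus the inner product of the error of the answer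
with a vector that is known before the answer, of mean zero
(`IsSFOAnswer.exists_slideNoise_le`). Hence expectations are taken only once, at the end
(`moles_expected_le`). The numbers of oracle calls are bounded by the prescribed lengths of the
loops, on every path (`moles_counts_le`).
-/

/-! ### Frank-Wolfe and the Wolfe gap -/

/-- One Frank-Wolfe step number `t` from `u` for the squared distance to `z`. -/
noncomputable def fwStep {E : Type*} [NormedAddCommGroup E] [InnerProductSpace ℝ E]
    (lmo : E → E) (z : E) (t : ℕ) (u : E) : E :=
  (1 / ((t : ℝ) + 1)) • (((t : ℝ) - 1) • u + (2 : ℝ) • lmo (u - z))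

/-- The `i`-th Frank-Wolfe iterate after `u`, with no stopping test, when the first step has
number `t`. -/
noncomputable def fwIter {E : Type*} [NormedAddCommGroup E] [InnerProductSpace ℝ E]
    (lmo : E → E) (z : E) (t : ℕ) (u : E) : ℕ → E
  | 0 => u
  | i + 1 => fwStep lmo z (t + i) (fwIter lmo z t u i)

section FrankWolfe

variable {E : Type*} [NormedAddCommGroup E] [InnerProductSpace ℝ E]

theorem fwIter_succ' (lmo : E → E) (z : E) (t : ℕ) (u : E) (i : ℕ) :
    fwIter lmo z t u (i + 1) = fwIter lmo z (t + 1) (fwStep lmo z t u) i := by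
  induction i with
  | zero => rfl
  | succ i ih =>
    rw [fwIter, ih, fwIter]
    congr 1
    omega

theorem fwStep_mem {X : Set E} (hX : Convex ℝ X) {lmo : E → E} (hlmo : IsLMO X lmo) (z : E)
    {t : ℕ} (ht : 1 ≤ t) {u : E} (hu : u ∈ X) : fwStep lmo z t u ∈ X := by
  have ht' : (1 : ℝ) ≤ t := by exact_mod_cast ht
  have h := hX hu (hlmo (u - z)).1 (a := ((t : ℝ) - 1) / (t + 1)) (b := 2 / ((t : ℝ) + 1))
    (div_nonneg (by linarith) (by positivity)) (by positivity) (by field_simp; ring)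
  convert h using 1
  rw [fwStep, smul_add, smul_smul, smul_smul]
  congr 2 <;> ring

theorem fwIter_mem {X : Set E} (hX : Convex ℝ X) {lmo : E → E} (hlmo : IsLMO X lmo) (z : E)
    {t : ℕ} (ht : 1 ≤ t) {u : E} (hu : u ∈ X) (i : ℕ) : fwIter lmo z t u i ∈ X := by
  induction i with
  | zero => exact hu
  | succ i ih => exact fwStep_mem hX hlmo z (by omega) ih

theorem fwProjection_mem {X : Set E} (hX : Convex ℝ X) {lmo : E → E} (hlmo : IsLMO X lmo)
    (z : E) (β η : ℝ) (n : ℕ) {t : ℕ} (ht : 1 ≤ t) {u : E} (hu : u ∈ X) :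
    (fwProjection lmo z β η n t u).1 ∈ X := by
  induction n generalizing t u with
  | zero => exact hu
  | succ n ih =>
    rw [fwProjection]
    split_ifs
    · exact hu
    · exact ih (by omega) (fwStep_mem hX hlmo z ht hu)

theorem fwProjection_calls_le (lmo : E → E) (z : E) (β η : ℝ) (n t : ℕ) (u : E) :
    (fwProjection lmo z β η n t u).2 ≤ n := by
  induction n generalizing t u with
  | zero => exact le_rfl
  | succ n ih =>
    rw [fwProjection]
    split_ifs
    · simp
    · exact Nat.succ_le_succ (ih _ _)

/-- The procedure either stops at a point with small Wolfe gap, or runs through all the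
unstopped iterates, none of which has passed the test. -/
theorem fwProjection_cases (lmo : E → E) (z : E) (β η : ℝ) (n t : ℕ) (u : E) :
    (β * inner ℝ ((fwProjection lmo z β η n t u).1 - z)
        ((fwProjection lmo z β η n t u).1 - lmo ((fwProjection lmo z β η n t u).1 - z)) ≤ η) ∨
      ((fwProjection lmo z β η n t u).1 = fwIter lmo z t u n ∧
        ∀ i < n, η < β * inner ℝ (fwIter lmo z t u i - z)
          (fwIter lmo z t u i - lmo (fwIter lmo z t u i - z))) := by
  induction n generalizing t u with
  | zero => exact Or.inr ⟨rfl, by simp⟩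
  | succ n ih =>
    rw [fwProjection]
    split_ifs with h
    · exact Or.inl h
    · rcases ih (t + 1) (fwStep lmo z t u) with h1 | ⟨h1, h2⟩
      · exact Or.inl h1
      · refine Or.inr ⟨by rw [fwIter_succ']; exact h1, fun i hi => ?_⟩
        rcases i with _ | i
        · exact not_le.1 h
        · rw [fwIter_succ']
          exact h2 i (by omega)

/-- The first Frank-Wolfe phase: the primal gap decays like `2 * C / (i + 2)`. -/
theorem fw_primal_gap_le {h g : ℕ → ℝ} {C : ℝ} (hC : 0 ≤ C) {n : ℕ}
    (hstep : ∀ i < n, h (i + 1) ≤ h i - 2 / ((i : ℝ) + 2) * g i + 2 * C / ((i : ℝ) + 2) ^ 2)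
    (hg : ∀ i < n, h i ≤ g i) (i : ℕ) (hi : 1 ≤ i) (hin : i ≤ n) :
    h i ≤ 2 * C / ((i : ℝ) + 2) := by
  induction i, hi using Nat.le_induction with
  | base =>
    have h1 := hstep 0 (by omega)
    have h2 := hg 0 (by omega)
    norm_num at h1 ⊢
    linarith
  | succ i hi ih =>
    have h1 := hstep i (by omega)
    have h2 := hg i (by omega)
    have h3 := ih (by omega)
    have hi0 : (0 : ℝ) ≤ i := by positivity
    have h4 : 2 / ((i : ℝ) + 2) * h i ≤ 2 / ((i : ℝ) + 2) * g i := by gcongr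
    have h5 : (i / ((i : ℝ) + 2)) * h i ≤ (i / ((i : ℝ) + 2)) * (2 * C / ((i : ℝ) + 2)) := by
      gcongr
    have h6 : h i - 2 / ((i : ℝ) + 2) * h i = (i / ((i : ℝ) + 2)) * h i := by
      field_simp; ring
    have h7 : (i / ((i : ℝ) + 2)) * (2 * C / ((i : ℝ) + 2)) + 2 * C / ((i : ℝ) + 2) ^ 2
        ≤ 2 * C / ((i : ℝ) + 1 + 2) := by
      have : (i / ((i : ℝ) + 2)) * (2 * C / ((i : ℝ) + 2)) + 2 * C / ((i : ℝ) + 2) ^ 2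
          = 2 * C * (i + 1) / ((i : ℝ) + 2) ^ 2 := by field_simp
      rw [this, div_le_div_iff₀ (by positivity) (by positivity)]
      nlinarith
    push_cast
    linarith

/-- The Wolfe gap of Frank-Wolfe cannot stay above `7 * C / n` for `n ≥ 2` steps. The second phase
starts at `m = n / 2`, where the primal gap is `O(C / n)`; from there on every step decreases the
primal gap by at least `2 * τ / (n + 1)`, up to curvature terms with a telescoping bound. -/
theorem fw_wolfe_gap_false {h g : ℕ → ℝ} {C τ : ℝ} (hC : 0 < C) {n : ℕ} (hn : 2 ≤ n)
    (hstep : ∀ i < n, h (i + 1) ≤ h i - 2 / ((i : ℝ) + 2) * g i + 2 * C / ((i : ℝ) + 2) ^ 2)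
    (hg : ∀ i < n, h i ≤ g i) (hτ : ∀ i < n, τ < g i) (hlast : 0 ≤ h n)
    (hCτ : 7 * C ≤ τ * n) : False := by
  have hn0 : (0 : ℝ) < n := by positivity
  have hτ0 : 0 ≤ τ := by
    by_contra! hneg
    nlinarith
  obtain ⟨m, hm⟩ : ∃ m, m = n / 2 := ⟨_, rfl⟩
  have key : ∀ j, m ≤ j → j ≤ n → h j ≤ 2 * C / ((m : ℝ) + 2)
      + 2 * C * (1 / ((m : ℝ) + 1) - 1 / ((j : ℝ) + 1)) - ((j : ℝ) - m) * (2 / (n + 1) * τ) := by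
    intro j hj
    induction j, hj using Nat.le_induction with
    | base =>
      intro hmn
      have := fw_primal_gap_le hC.le hstep hg m (by omega) hmn
      simpa using this
    | succ j hj ih =>
      intro hjn
      have h1 := hstep j (by omega)
      have h2 := ih (by omega)
      have h3 : (j : ℝ) + 1 ≤ n := by exact_mod_cast hjn
      have h4 : 2 / ((n : ℝ) + 1) * τ ≤ 2 / ((j : ℝ) + 2) * g j := by
        have := (hτ j (by omega)).le
        gcongr ?_ * ?_
        exact div_le_div_of_nonneg_left (by norm_num) (by positivity) (by linarith)
      have h5 : 2 * C / ((j : ℝ) + 2) ^ 2 ≤ 2 * C * (1 / ((j : ℝ) + 1) - 1 / ((j : ℝ) + 1 + 1)) := by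
        have : 1 / ((j : ℝ) + 1) - 1 / ((j : ℝ) + 1 + 1) = 1 / (((j : ℝ) + 1) * (j + 2)) := by
          field_simp; ring
        rw [this, mul_one_div]
        apply div_le_div_of_nonneg_left (by positivity) (by positivity)
        nlinarith
      push_cast
      linarith
  have hfin := key n (by omega) le_rfl
  have h8 : 2 * C / ((m : ℝ) + 2) ≤ 2 * C / ((m : ℝ) + 1) := by
    apply div_le_div_of_nonneg_left (by positivity) (by positivity) (by linarith)
  have h9 : 0 ≤ (2 * C / ((m : ℝ) + 1) + 2 * C * (1 / ((m : ℝ) + 1) - 1 / ((n : ℝ) + 1))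
      - ((n : ℝ) - m) * (2 / (n + 1) * τ)) * ((m + 1) * (n + 1)) :=
    mul_nonneg (by linarith) (by positivity)
  have h10 : (2 * C / ((m : ℝ) + 1) + 2 * C * (1 / ((m : ℝ) + 1) - 1 / ((n : ℝ) + 1))
      - ((n : ℝ) - m) * (2 / (n + 1) * τ)) * ((m + 1) * (n + 1))
      = 4 * C * (n + 1) - 2 * C * (m + 1) - 2 * ((n : ℝ) - m) * τ * (m + 1) := by
    field_simp; ring
  rw [h10] at h9
  rcases Nat.even_or_odd n with ⟨q, hq⟩ | ⟨q, hq⟩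
  · have : m = q := by omega
    subst this
    have : (n : ℝ) = m + m := by exact_mod_cast hq
    rw [this] at h9 hCτ
    have hm0 : (0 : ℝ) ≤ m := by positivity
    nlinarith
  · have : m = q := by omega
    subst this
    have : (n : ℝ) = 2 * m + 1 := by exact_mod_cast hq
    rw [this] at h9 hCτ
    have hm0 : (0 : ℝ) ≤ m := by positivity
    have h11 : 7 * C * (m + 1) ≤ τ * (2 * m + 1) * (m + 1) := by gcongr
    nlinarith [mul_nonneg (mul_nonneg hτ0 hm0) hm0, mul_nonneg hτ0 hm0]

/-- **Guarantee of the Frank-Wolfe projection**: with `n ≥ 7 * β * D ^ 2 / η` steps, the returned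
point is an `η`-approximate solution of the variational inequality that characterizes the
projection of `z` onto `X`. -/
theorem fwProjection_gap_le {X : Set E} (hX : Convex ℝ X) {lmo : E → E} (hlmo : IsLMO X lmo)
    {D : ℝ} (hD : ∀ a ∈ X, ∀ b ∈ X, ‖a - b‖ ≤ D) (z : E) {β η : ℝ} (hβ : 0 < β) {n : ℕ}
    (hη : 7 * (β * D ^ 2) ≤ η * n) (hη0 : 0 ≤ η) {u : E} (hu : u ∈ X) {x : E} (hx : x ∈ X) :
    β * inner ℝ ((fwProjection lmo z β η n 1 u).1 - z)
      ((fwProjection lmo z β η n 1 u).1 - x) ≤ η := by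
  have hmem := fwProjection_mem hX hlmo z β η n le_rfl hu
  have hcases := fwProjection_cases lmo z β η n 1 u
  generalize (fwProjection lmo z β η n 1 u).1 = p at *
  have hD0 : 0 ≤ D := (norm_nonneg _).trans (hD x hx x hx)
  rcases hD0.eq_or_lt with hD0 | hD0
  · have : p - x = 0 := norm_le_zero_iff.1 (hD0 ▸ hD p hmem x hx)
    simpa [this] using hη0
  rcases hcases with h | ⟨rfl, hgap⟩
  · have h1 := (hlmo (p - z)).2 x hx
    refine le_trans ?_ h
    rw [inner_sub_right, inner_sub_right]
    gcongr
  set v := fwIter lmo z 1 u with hv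
  have hvX : ∀ i, v i ∈ X := fwIter_mem hX hlmo z le_rfl hu
  have hvs : ∀ i, v (i + 1) = v i + (2 / ((i : ℝ) + 2)) • (lmo (v i - z) - v i) := by
    intro i
    rw [hv, fwIter, fwStep, ← hv]
    push_cast
    have e1 : (1 / (1 + (i : ℝ) + 1)) * (1 + (i : ℝ) - 1) = 1 - 2 / ((i : ℝ) + 2) := by
      field_simp; ring
    have e2 : (1 / (1 + (i : ℝ) + 1)) * 2 = 2 / ((i : ℝ) + 2) := by field_simp; ring
    rw [smul_add, smul_smul, smul_smul, e1, e2]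
    module
  rcases Nat.lt_or_ge n 2 with hn | hn
  · interval_cases n
    · norm_num at hη
      nlinarith [mul_pos hβ (pow_pos hD0 2)]
    · -- After one step the iterate is an LMO answer, whose Wolfe gap is at most `β * D ^ 2`.
      have e : v 1 = lmo (u - z) := by
        have := hvs 0
        simp only [Nat.cast_zero, zero_add] at this
        rw [this]
        simp [hv, fwIter]
      have h1 := (hlmo (u - z)).2 x hx
      have h2 : inner ℝ (v 1 - z) (v 1 - x) ≤ D ^ 2 := by
        have h3 : inner ℝ (v 1 - z) (v 1 - x)
            = inner ℝ (v 1 - u) (v 1 - x) + (inner ℝ (u - z) (v 1) - inner ℝ (u - z) x) := by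
          rw [← inner_sub_right, ← inner_add_left]
          congr 1
          abel
        have h4 := real_inner_le_norm (v 1 - u) (v 1 - x)
        have h5 : ‖v 1 - u‖ * ‖v 1 - x‖ ≤ D * D :=
          mul_le_mul (hD _ (hvX 1) _ hu) (hD _ (hvX 1) _ hx) (norm_nonneg _) hD0.le
        rw [← e] at h1
        rw [h3]
        nlinarith
      have h6 : β * inner ℝ (v 1 - z) (v 1 - x) ≤ β * D ^ 2 := by gcongr
      norm_num at hη
      nlinarith [mul_pos hβ (pow_pos hD0 2)]
  · exfalso
    -- The primal gap is measured relative to the last iterate, which needs no minimizer.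
    refine fw_wolfe_gap_false (h := fun i => ‖v i - z‖ ^ 2 / 2 - ‖v n - z‖ ^ 2 / 2)
      (g := fun i => inner ℝ (v i - z) (v i - lmo (v i - z))) (C := D ^ 2) (τ := η / β)
      (by positivity) hn ?_ ?_ ?_ ?_ ?_
    · intro i _
      have h1 : v (i + 1) - z = (v i - z) - (2 / ((i : ℝ) + 2)) • (v i - lmo (v i - z)) := by
        rw [hvs i]; module
      have h2 : ‖v i - lmo (v i - z)‖ ^ 2 ≤ D ^ 2 := by
        have := hD _ (hvX i) _ (hlmo (v i - z)).1
        gcongr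
      have h3 : (2 / ((i : ℝ) + 2)) ^ 2 / 2 * ‖v i - lmo (v i - z)‖ ^ 2
          ≤ (2 / ((i : ℝ) + 2)) ^ 2 / 2 * D ^ 2 := by gcongr
      have h4 : (2 / ((i : ℝ) + 2)) ^ 2 / 2 * D ^ 2 = 2 * D ^ 2 / ((i : ℝ) + 2) ^ 2 := by
        field_simp
      have h5 := norm_sub_sq_real (v i - z) ((2 / ((i : ℝ) + 2)) • (v i - lmo (v i - z)))
      rw [← h1, norm_smul, mul_pow, Real.norm_eq_abs, sq_abs, inner_smul_right] at h5
      linarith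
    · intro i _
      have h1 := (hlmo (v i - z)).2 (v n) (hvX n)
      have h2 := norm_sub_sq_real (v i - z) (v i - v n)
      have h3 : v i - z - (v i - v n) = v n - z := by abel
      rw [h3] at h2
      have h4 := inner_sub_right (𝕜 := ℝ) (v i - z) (v i) (v n)
      have h5 := inner_sub_right (𝕜 := ℝ) (v i - z) (v i) (lmo (v i - z))
      have h6 := sq_nonneg ‖v i - v n‖
      show ‖v i - z‖ ^ 2 / 2 - ‖v n - z‖ ^ 2 / 2 ≤ inner ℝ (v i - z) (v i - lmo (v i - z))
      linarith
    · intro i hi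
      rw [div_lt_iff₀ hβ, mul_comm]
      exact hgap i hi
    · simp
    · rw [div_mul_eq_mul_div, le_div_iff₀ hβ]
      linarith

end FrankWolfe

/-! ### The Prox-Slide procedure, path by path -/

section ProxSlide

variable {E : Type*} [NormedAddCommGroup E] [InnerProductSpace ℝ E]

theorem norm_projBall_le {R : ℝ} (hR : 0 ≤ R) (v : E) : ‖projBall R v‖ ≤ R := by
  rcases eq_or_ne v 0 with rfl | hv
  · simpa [projBall] using hR
  have hv' : 0 < ‖v‖ := norm_pos_iff.2 hv
  rw [projBall, norm_smul, Real.norm_of_nonneg (le_min zero_le_one (by positivity))]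
  calc min 1 (R / ‖v‖) * ‖v‖ ≤ R / ‖v‖ * ‖v‖ := by gcongr; exact min_le_right _ _
    _ = R := by field_simp

/-- The variational inequality that characterizes the projection onto the ball. -/
theorem inner_sub_projBall_nonneg {R : ℝ} (v : E) {u : E} (hu : ‖u‖ ≤ R) :
    0 ≤ inner ℝ (v - projBall R v) (projBall R v - u) := by
  rcases eq_or_ne v 0 with rfl | hv
  · simp [projBall]
  have hv' : 0 < ‖v‖ := norm_pos_iff.2 hv
  rcases le_total ‖v‖ R with h | h
  · have : projBall R v = v := by
      rw [projBall, min_eq_left ((one_le_div hv').2 h), one_smul]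
    simp [this]
  · have e : projBall R v = (R / ‖v‖) • v := by
      rw [projBall, min_eq_right ((div_le_one hv').2 h)]
    have e1 : v - (R / ‖v‖) • v = (1 - R / ‖v‖) • v := by module
    rw [e, e1, real_inner_smul_left, inner_sub_right, real_inner_smul_right,
      real_inner_self_eq_norm_sq]
    have h1 : R / ‖v‖ ≤ 1 := (div_le_one hv').2 h
    have h2 : inner ℝ v u ≤ ‖v‖ * R := (real_inner_le_norm v u).trans (by gcongr)
    have h3 : R / ‖v‖ * ‖v‖ ^ 2 = ‖v‖ * R := by field_simp
    exact mul_nonneg (by linarith) (by linarith)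

/-- The Prox-Slide iterate is the exact minimizer over the ball of
`⟪g + ghat, u⟫ + (β / 2) * ‖u - u₀‖ ^ 2 + (β * p / 2) * ‖u - v‖ ^ 2`, which is strongly convex. -/
theorem projBall_three_point {R β p : ℝ} (hβ : 0 < β) (hp : 0 < p) (g ghat u₀ v : E) {u : E}
    (hu : ‖u‖ ≤ R) (w : E)
    (hw : w = projBall R (v - (1 / ((1 + p) * β)) • (ghat + β • (v - (u₀ - (1 / β) • g))))) :
    inner ℝ (g + ghat) (w - u) + β / 2 * ‖w - u₀‖ ^ 2 + β * p / 2 * ‖w - v‖ ^ 2 ≤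
      β / 2 * ‖u - u₀‖ ^ 2 + β * p / 2 * ‖u - v‖ ^ 2 - β * (1 + p) / 2 * ‖u - w‖ ^ 2 := by
  have h := inner_sub_projBall_nonneg
    (v - (1 / ((1 + p) * β)) • (ghat + β • (v - (u₀ - (1 / β) • g)))) hu
  rw [← hw] at h
  have e : v - (1 / ((1 + p) * β)) • (ghat + β • (v - (u₀ - (1 / β) • g))) - w
      = (1 / ((1 + p) * β)) • (-(g + ghat) - β • (w - u₀) - (β * p) • (w - v)) := by
    match_scalars <;> field_simp <;> ring
  rw [e, real_inner_smul_left] at h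
  have h' := nonneg_of_mul_nonneg_right h (by positivity : 0 < 1 / ((1 + p) * β))
  rw [inner_sub_left, inner_sub_left, inner_neg_left, real_inner_smul_left,
    real_inner_smul_left] at h'
  have q : ∀ a : E, ‖u - a‖ ^ 2 = ‖w - a‖ ^ 2 - 2 * inner ℝ (w - a) (w - u) + ‖u - w‖ ^ 2 := by
    intro a
    have := norm_sub_sq_real (w - a) (w - u)
    rw [norm_sub_rev u w, ← this]
    congr 2
    abel
  rw [q u₀, q v]
  linarith

theorem norm_sq_convex_comb (a b : ℝ) (hab : a + b = 1) (p q : E) :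
    ‖a • p + b • q‖ ^ 2 = a * ‖p‖ ^ 2 + b * ‖q‖ ^ 2 - a * b * ‖p - q‖ ^ 2 := by
  rw [norm_add_sq_real, norm_sub_sq_real, norm_smul, norm_smul, real_inner_smul_left,
    real_inner_smul_right, mul_pow, mul_pow, Real.norm_eq_abs, Real.norm_eq_abs, sq_abs, sq_abs]
  obtain rfl : b = 1 - a := by linarith
  ring

theorem proxSlide_u_mem {R : ℝ} (hR : 0 ≤ R) (ghat : ℕ → E) (g : E) {u₀ : E} (hu₀ : ‖u₀‖ ≤ R)
    (β : ℝ) (n : ℕ) : ‖(proxSlide R ghat g u₀ β n).u‖ ≤ R := by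
  cases n with
  | zero => exact hu₀
  | succ n => exact norm_projBall_le hR _

theorem proxSlide_theta {n : ℕ} :
    1 - 2 * ((n : ℝ) + 1 + 1) / (((n : ℝ) + 1) * ((n : ℝ) + 1 + 3))
      = n * ((n : ℝ) + 3) / (((n : ℝ) + 1) * ((n : ℝ) + 4)) := by
  field_simp
  ring

theorem proxSlide_avg_mem {R : ℝ} (hR : 0 ≤ R) (ghat : ℕ → E) (g : E) {u₀ : E} (hu₀ : ‖u₀‖ ≤ R)
    (β : ℝ) (n : ℕ) : ‖(proxSlide R ghat g u₀ β n).avg‖ ≤ R := by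
  induction n with
  | zero => exact hu₀
  | succ n ih =>
    have h := (show Convex ℝ (Metric.closedBall (0 : E) R) from convex_closedBall 0 R)
      (mem_closedBall_zero_iff.2 ih)
      (mem_closedBall_zero_iff.2 (proxSlide_u_mem hR ghat g hu₀ β (n + 1)))
      (a := 1 - 2 * ((n : ℝ) + 1 + 1) / (((n : ℝ) + 1) * ((n : ℝ) + 1 + 3)))
      (b := 2 * ((n : ℝ) + 1 + 1) / (((n : ℝ) + 1) * ((n : ℝ) + 1 + 3)))
      (by rw [proxSlide_theta]; positivity) (by positivity) (by ring)
    exact mem_closedBall_zero_iff.1 h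

theorem proxSlide_sfoCalls (R : ℝ) (ghat : ℕ → E) (g u₀ : E) (β : ℝ) (n : ℕ) :
    (proxSlide R ghat g u₀ β n).sfoCalls = n := by
  induction n with
  | zero => rfl
  | succ n ih => rw [proxSlide]; simp [ih]

/-- The objective of the Prox-Slide procedure. -/
noncomputable def slideObj (f : E → ℝ) (g u₀ : E) (β : ℝ) (u : E) : ℝ :=
  inner ℝ g u + f u + β / 2 * ‖u - u₀‖ ^ 2

theorem slideObj_convex_comb_le {R β : ℝ} (hβ : 0 ≤ β) {f : E → ℝ}
    (hf : ConvexOn ℝ (Metric.closedBall 0 R) f) (g u₀ : E) {a b : ℝ} (ha : 0 ≤ a) (hb : 0 ≤ b)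
    (hab : a + b = 1) {p q : E} (hp : ‖p‖ ≤ R) (hq : ‖q‖ ≤ R) :
    slideObj f g u₀ β (a • p + b • q) ≤ a * slideObj f g u₀ β p + b * slideObj f g u₀ β q := by
  have h1 := hf.2 (mem_closedBall_zero_iff.2 hp) (mem_closedBall_zero_iff.2 hq) ha hb hab
  have h2 := norm_sq_convex_comb a b hab (p - u₀) (q - u₀)
  have h3 : a • p + b • q - u₀ = a • (p - u₀) + b • (q - u₀) := by
    obtain rfl : b = 1 - a := by linarith
    module
  rw [← h3] at h2
  have h4 : 0 ≤ a * b * ‖p - u₀ - (q - u₀)‖ ^ 2 := by positivity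
  have h5 : β / 2 * ‖a • p + b • q - u₀‖ ^ 2
      ≤ β / 2 * (a * ‖p - u₀‖ ^ 2 + b * ‖q - u₀‖ ^ 2) := by
    gcongr
    linarith
  simp only [slideObj, inner_add_right, real_inner_smul_right, smul_eq_mul] at *
  linarith

/-- The contribution to the error of Prox-Slide of an oracle answer that differs by `δ` from a
subgradient, in step `t + 1`, when the iterate differs by `v` from the comparison point. -/
noncomputable def slideNoise (G β : ℝ) (t : ℕ) (δ v : E) : ℝ :=
  ((t : ℝ) + 2) * ((2 * G + ‖δ‖) ^ 2 / (β * ((t : ℝ) + 1)) - inner ℝ δ v)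

/-- Progress of a single Prox-Slide step. -/
theorem proxSlide_step_le {R β G : ℝ} (hβ : 0 < β) {f : E → ℝ}
    (hLip : ∀ x ∈ Metric.closedBall (0 : E) R, ∀ y ∈ Metric.closedBall (0 : E) R,
      |f y - f x| ≤ G * ‖y - x‖)
    (ghat : ℕ → E) (g : E) {u₀ : E} (hR : 0 ≤ R) (hu₀ : ‖u₀‖ ≤ R) (n : ℕ) {sg : E}
    (hsg : IsSubgradientOn f (Metric.closedBall 0 R) (proxSlide R ghat g u₀ β n).u sg)
    (hsgG : ‖sg‖ ≤ G) {u : E} (hu : ‖u‖ ≤ R) :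
    slideObj f g u₀ β (proxSlide R ghat g u₀ β (n + 1)).u - slideObj f g u₀ β u ≤
      β * (((n : ℝ) + 1) / 2) / 2 * ‖u - (proxSlide R ghat g u₀ β n).u‖ ^ 2
      - β * (1 + ((n : ℝ) + 1) / 2) / 2 * ‖u - (proxSlide R ghat g u₀ β (n + 1)).u‖ ^ 2
      + ((2 * G + ‖ghat n - sg‖) ^ 2 / (β * ((n : ℝ) + 1))
        - inner ℝ (ghat n - sg) ((proxSlide R ghat g u₀ β n).u - u)) := by
  have hw : (proxSlide R ghat g u₀ β (n + 1)).u = projBall R ((proxSlide R ghat g u₀ β n).u -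
      (1 / ((1 + ((n : ℝ) + 1) / 2) * β)) •
        (ghat n + β • ((proxSlide R ghat g u₀ β n).u - (u₀ - (1 / β) • g)))) := rfl
  have hwR := proxSlide_u_mem hR ghat g hu₀ β (n + 1)
  have hvR := proxSlide_u_mem hR ghat g hu₀ β n
  have h1 := projBall_three_point hβ (p := ((n : ℝ) + 1) / 2) (by positivity) g (ghat n) u₀
    (proxSlide R ghat g u₀ β n).u hu _ hw
  generalize (proxSlide R ghat g u₀ β (n + 1)).u = w at *
  generalize (proxSlide R ghat g u₀ β n).u = v at *
  -- By `h2` and `h4`, linearizing `f` at the old iterate costs at most `2 * G * ‖w - v‖`.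
  have h2 := (abs_le.1 (hLip v (mem_closedBall_zero_iff.2 hvR) w
    (mem_closedBall_zero_iff.2 hwR))).2
  have h3 := hsg u (mem_closedBall_zero_iff.2 hu)
  have h4 : -(inner ℝ sg (w - v)) ≤ G * ‖w - v‖ := by
    have := (abs_le.1 (abs_real_inner_le_norm sg (w - v))).1
    have : ‖sg‖ * ‖w - v‖ ≤ G * ‖w - v‖ := by gcongr
    linarith
  have h5 : -(inner ℝ (ghat n - sg) (w - v)) ≤ ‖ghat n - sg‖ * ‖w - v‖ := by
    have := (abs_le.1 (abs_real_inner_le_norm (ghat n - sg) (w - v))).1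
    linarith
  -- Young's inequality absorbs the linear terms into the proximal term.
  have h6 : (2 * G + ‖ghat n - sg‖) * ‖w - v‖ ≤ β * (((n : ℝ) + 1) / 2) / 2 * ‖w - v‖ ^ 2
      + (2 * G + ‖ghat n - sg‖) ^ 2 / (β * ((n : ℝ) + 1)) := by
    have hq : 0 < β * ((n : ℝ) + 1) := by positivity
    have : 0 ≤ (β * ((n : ℝ) + 1) * ‖w - v‖ / 2 - (2 * G + ‖ghat n - sg‖)) ^ 2
        / (β * ((n : ℝ) + 1)) := by positivity
    have e : (β * ((n : ℝ) + 1) * ‖w - v‖ / 2 - (2 * G + ‖ghat n - sg‖)) ^ 2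
        / (β * ((n : ℝ) + 1)) = β * (((n : ℝ) + 1) / 2) / 2 * ‖w - v‖ ^ 2
      + (2 * G + ‖ghat n - sg‖) ^ 2 / (β * ((n : ℝ) + 1))
      - (2 * G + ‖ghat n - sg‖) * ‖w - v‖ := by
      field_simp; ring
    linarith
  simp only [slideObj]
  simp only [inner_add_left, inner_sub_right, inner_sub_left] at *
  linarith

/-- **Pathwise guarantee of Prox-Slide.** The weights `t + 1` make the distances to the
comparison point telescope. -/
theorem proxSlide_bound {R β G : ℝ} (hβ : 0 < β) {f : E → ℝ}
    (hf : ConvexOn ℝ (Metric.closedBall 0 R) f)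
    (hLip : ∀ x ∈ Metric.closedBall (0 : E) R, ∀ y ∈ Metric.closedBall (0 : E) R,
      |f y - f x| ≤ G * ‖y - x‖)
    (ghat : ℕ → E) (g : E) {u₀ : E} (hR : 0 ≤ R) (hu₀ : ‖u₀‖ ≤ R) (sg : ℕ → E) (n : ℕ)
    (hsg : ∀ t < n, IsSubgradientOn f (Metric.closedBall 0 R) (proxSlide R ghat g u₀ β t).u (sg t))
    (hsgG : ∀ t < n, ‖sg t‖ ≤ G) {u : E} (hu : ‖u‖ ≤ R) :
    (n : ℝ) * (n + 3) / 2 *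
        (slideObj f g u₀ β (proxSlide R ghat g u₀ β n).avg - slideObj f g u₀ β u) ≤
      β / 2 * (‖u - u₀‖ ^ 2
        - ((n : ℝ) + 1) * (n + 2) / 2 * ‖u - (proxSlide R ghat g u₀ β n).u‖ ^ 2)
      + ∑ t ∈ Finset.range n,
          slideNoise G β t (ghat t - sg t) ((proxSlide R ghat g u₀ β t).u - u) := by
  induction n with
  | zero => simp [proxSlide]
  | succ n ih =>
    have h1 := ih (fun t ht => hsg t (by omega)) (fun t ht => hsgG t (by omega))
    have h2 := proxSlide_step_le hβ hLip ghat g hR hu₀ n (hsg n (by omega)) (hsgG n (by omega)) hu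
    have h3 := slideObj_convex_comb_le hβ.le hf g u₀
      (a := 1 - 2 * ((n : ℝ) + 1 + 1) / (((n : ℝ) + 1) * ((n : ℝ) + 1 + 3)))
      (b := 2 * ((n : ℝ) + 1 + 1) / (((n : ℝ) + 1) * ((n : ℝ) + 1 + 3)))
      (by rw [proxSlide_theta]; positivity) (by positivity) (by ring)
      (proxSlide_avg_mem hR ghat g hu₀ β n) (proxSlide_u_mem hR ghat g hu₀ β (n + 1))
    have e : (proxSlide R ghat g u₀ β (n + 1)).avg =
      (1 - 2 * ((n : ℝ) + 1 + 1) / (((n : ℝ) + 1) * ((n : ℝ) + 1 + 3))) •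
        (proxSlide R ghat g u₀ β n).avg +
      (2 * ((n : ℝ) + 1 + 1) / (((n : ℝ) + 1) * ((n : ℝ) + 1 + 3))) •
        (proxSlide R ghat g u₀ β (n + 1)).u := rfl
    rw [← e, proxSlide_theta] at h3
    rw [Finset.sum_range_succ, slideNoise]
    generalize slideObj f g u₀ β (proxSlide R ghat g u₀ β (n + 1)).avg = A' at *
    generalize slideObj f g u₀ β (proxSlide R ghat g u₀ β n).avg = A at *
    generalize slideObj f g u₀ β (proxSlide R ghat g u₀ β (n + 1)).u = B at *
    generalize slideObj f g u₀ β u = F at *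
    generalize ((2 * G + ‖ghat n - sg n‖) ^ 2 / (β * ((n : ℝ) + 1))
        - inner ℝ (ghat n - sg n) ((proxSlide R ghat g u₀ β n).u - u)) = N at *
    have h4 : ((n : ℝ) + 1) * ((n : ℝ) + 1 + 3) / 2 * A' ≤ ((n : ℝ) + 1) * ((n : ℝ) + 1 + 3) / 2 *
        (n * ((n : ℝ) + 3) / (((n : ℝ) + 1) * ((n : ℝ) + 4)) * A
          + 2 * ((n : ℝ) + 1 + 1) / (((n : ℝ) + 1) * ((n : ℝ) + 1 + 3)) * B) := by gcongr
    have h5 : ((n : ℝ) + 1) * ((n : ℝ) + 1 + 3) / 2 *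
        (n * ((n : ℝ) + 3) / (((n : ℝ) + 1) * ((n : ℝ) + 4)) * A
          + 2 * ((n : ℝ) + 1 + 1) / (((n : ℝ) + 1) * ((n : ℝ) + 1 + 3)) * B)
        = n * (n + 3) / 2 * A + (n + 2) * B := by
      have : (n : ℝ) + 1 + 3 = n + 4 := by ring
      rw [this]
      field_simp
      ring
    have h6 := mul_le_mul_of_nonneg_left h2 (by positivity : (0 : ℝ) ≤ n + 2)
    push_cast
    linarith

end ProxSlide

/-! ### Outer iterations, path by path -/

section MolesBound

variable {E : Type*} [NormedAddCommGroup E] [InnerProductSpace ℝ E]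

/-- The value at `(x, x')` of the penalized objective `f x' + ‖x - x'‖ ^ 2 / (2 * lam)`, in which
the constraint `x = x'` has been relaxed. -/
noncomputable def penalized (f : E → ℝ) (lam : ℝ) (x x' : E) : ℝ :=
  f x' + ‖x - x'‖ ^ 2 / (2 * lam)

/-- The smoothness and convexity estimates of accelerated gradient descent, for the penalty
`‖x - x'‖ ^ 2 / (2 * lam)`, which is quadratic with smoothness constant `2 / lam`. -/
theorem penalty_extrapolation_le {lam γ : ℝ} (hlam : 0 < lam) (hγ : 0 ≤ γ) (hγ1 : γ ≤ 1)
    (x x' z z' p q : E) :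
    ‖((1 - γ) • x + γ • p) - ((1 - γ) • x' + γ • q)‖ ^ 2 / (2 * lam) ≤
      (1 - γ) * (‖x - x'‖ ^ 2 / (2 * lam))
      + γ * inner ℝ ((1 / lam) • (((1 - γ) • x + γ • z) - ((1 - γ) • x' + γ • z'))) (p - q)
      + γ ^ 2 / lam * (‖p - z‖ ^ 2 + ‖q - z'‖ ^ 2) := by
  obtain ⟨b, hb⟩ : ∃ b, b = ((1 - γ) • x + γ • z) - ((1 - γ) • x' + γ • z') := ⟨_, rfl⟩
  have e1 : ((1 - γ) • x + γ • p) - ((1 - γ) • x' + γ • q)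
      = b + γ • ((p - z) - (q - z')) := by rw [hb]; module
  have e2 : γ • (p - q) = b + γ • ((p - z) - (q - z')) - (1 - γ) • (x - x') := by
    rw [hb]; module
  have h1 := norm_sub_sq_real (p - z) (q - z')
  have h2 := norm_add_sq_real (p - z) (q - z')
  have h3 := sq_nonneg ‖(p - z) + (q - z')‖
  have h4 : ‖(p - z) - (q - z')‖ ^ 2 ≤ 2 * (‖p - z‖ ^ 2 + ‖q - z'‖ ^ 2) := by linarith
  have h5 : γ ^ 2 * ‖(p - z) - (q - z')‖ ^ 2
      ≤ γ ^ 2 * (2 * (‖p - z‖ ^ 2 + ‖q - z'‖ ^ 2)) := by gcongr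
  have h6 : γ * inner ℝ ((1 / lam) • b) (p - q)
      = 1 / lam * (‖b‖ ^ 2 + γ * inner ℝ b ((p - z) - (q - z')) - (1 - γ) * inner ℝ b (x - x')) := by
    rw [← real_inner_smul_right, e2, real_inner_smul_left, inner_sub_right, inner_add_right,
      real_inner_smul_right, real_inner_smul_right, real_inner_self_eq_norm_sq]
  rw [e1, ← hb, h6, norm_add_sq_real, norm_smul, mul_pow, Real.norm_eq_abs, sq_abs,
    real_inner_smul_right]
  have h7 : 0 ≤ (1 - γ) * ‖x - x' - b‖ ^ 2 := mul_nonneg (by linarith) (sq_nonneg _)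
  rw [norm_sub_sq_real, real_inner_comm] at h7
  have h8 : 0 ≤ γ * ‖b‖ ^ 2 := by positivity
  generalize inner ℝ b ((p - z) - (q - z')) = i1 at *
  generalize inner ℝ b (x - x') = i2 at *
  generalize ‖p - z‖ ^ 2 + ‖q - z'‖ ^ 2 = N at *
  have e : (1 - γ) * (‖x - x'‖ ^ 2 / (2 * lam))
      + 1 / lam * (‖b‖ ^ 2 + γ * i1 - (1 - γ) * i2) + γ ^ 2 / lam * N
      = ((1 - γ) * ‖x - x'‖ ^ 2 + 2 * (‖b‖ ^ 2 + γ * i1 - (1 - γ) * i2)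
        + γ ^ 2 * (2 * N)) / (2 * lam) := by
    field_simp
  rw [e]
  refine div_le_div_of_nonneg_right ?_ (by positivity)
  linarith

/-- The relative excess of the weight of the distance terms in Prox-Slide with `T` steps over
those in an exact proximal step. -/
noncomputable def slideExcess (T : ℕ) : ℝ := 2 / ((T : ℝ) * (T + 3))

theorem slideExcess_nonneg (T : ℕ) : 0 ≤ slideExcess T := by
  rw [slideExcess]; positivity

theorem slideExcess_anti {S T : ℕ} (hS : 1 ≤ S) (hST : S ≤ T) : slideExcess T ≤ slideExcess S := by
  have h1 : (1 : ℝ) ≤ S := by exact_mod_cast hS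
  have h2 : (S : ℝ) ≤ T := by exact_mod_cast hST
  rw [slideExcess, slideExcess]
  gcongr

theorem slideExcess_le {T : ℕ} (hT : 1 ≤ T) : slideExcess T ≤ 1 / 2 := by
  refine (slideExcess_anti le_rfl hT).trans ?_
  norm_num [slideExcess]

/-- The total weighted error of the oracle answers in one run of Prox-Slide with `T` steps from
the state `S`, where `sg t` is the subgradient that the answer `ghat t` estimates. -/
noncomputable def slideNoiseSum (P : MolesParams) (S : MolesState E) (ghat sg : ℕ → E) (k T : ℕ)
    (u : E) : ℝ :=
  slideExcess T * ∑ t ∈ Finset.range T,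
    slideNoise P.G (P.β k) t (ghat t - sg t) ((S.slide P ghat k t).u - u)

/-- Invariants of the state of MOLES: feasibility of its four points. -/
def MolesState.Feasible (S : MolesState E) (X : Set E) (R : ℝ) : Prop :=
  S.x ∈ X ∧ S.z ∈ X ∧ ‖S.x'‖ ≤ R ∧ ‖S.z'‖ ≤ R

namespace MolesState.Feasible

theorem step {S : MolesState E} {P : MolesParams} {X : Set E} (hS : S.Feasible X P.R)
    (hR : 0 ≤ P.R) (hX : Convex ℝ X) {lmo : E → E} (hlmo : IsLMO X lmo) (ghat : ℕ → E) {k : ℕ}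
    (hk : 1 ≤ k) : (S.step P lmo ghat k).Feasible X P.R := by
  obtain ⟨h1, h2, h3, h4⟩ := hS
  have hk' : (1 : ℝ) ≤ k := by exact_mod_cast hk
  have hγ0 : 0 ≤ P.γ k := by rw [MolesParams.γ]; positivity
  have hγ1 : 0 ≤ 1 - P.γ k := by
    rw [MolesParams.γ, sub_nonneg, div_le_one (by positivity)]
    linarith
  have hz : (S.project P lmo k).1 ∈ X := fwProjection_mem hX hlmo _ _ _ _ le_rfl h2
  refine ⟨hX h1 hz hγ1 hγ0 (by ring), hz, ?_, proxSlide_u_mem hR _ _ h4 _ _⟩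
  exact mem_closedBall_zero_iff.1 ((show Convex ℝ (Metric.closedBall (0 : E) P.R) from
    convex_closedBall 0 P.R) (mem_closedBall_zero_iff.2 h3)
    (mem_closedBall_zero_iff.2 (proxSlide_avg_mem hR _ _ h4 _ _)) hγ1 hγ0 (by ring))

end MolesState.Feasible

theorem moles_feasible {P : MolesParams} {X : Set E} (hX : Convex ℝ X)
    (hXR : X ⊆ Metric.closedBall 0 P.R) {lmo : E → E} (hlmo : IsLMO X lmo) {x₀ : E} (hx₀ : x₀ ∈ X)
    (ghat : ℕ → ℕ → E) (k : ℕ) : (moles P lmo x₀ ghat k).Feasible X P.R := by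
  have h0 : ‖x₀‖ ≤ P.R := mem_closedBall_zero_iff.1 (hXR hx₀)
  induction k with
  | zero => exact ⟨hx₀, hx₀, h0, h0⟩
  | succ k ih => exact ih.step ((norm_nonneg _).trans h0) hX hlmo _ (by omega)

/-- **Progress of one outer iteration**, in the weighting `k * (k + 1)` of accelerated methods. -/
theorem moles_step_bound {P : MolesParams} {X : Set E} (hX : Convex ℝ X)
    (hXR : X ⊆ Metric.closedBall 0 P.R) {lmo : E → E} (hlmo : IsLMO X lmo)
    (hD : ∀ a ∈ X, ∀ b ∈ X, ‖a - b‖ ≤ P.D) {f : E → ℝ}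
    (hf : ConvexOn ℝ (Metric.closedBall 0 P.R) f)
    (hLip : ∀ x ∈ Metric.closedBall (0 : E) P.R, ∀ y ∈ Metric.closedBall (0 : E) P.R,
      |f y - f x| ≤ P.G * ‖y - x‖)
    (hlam : 0 < P.lam) (hDt : 0 < P.Dtilde) (hc' : 0 < P.c') (hK : 0 < P.K)
    {S : MolesState E} (hS : S.Feasible X P.R) (n : ℕ) (hT : 1 ≤ P.T (n + 1)) (ghat sg : ℕ → E)
    (hsg : ∀ t < P.T (n + 1), IsSubgradientOn f (Metric.closedBall 0 P.R)
      (S.slide P ghat (n + 1) t).u (sg t) ∧ ‖sg t‖ ≤ P.G)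
    {x : E} (hx : x ∈ X) :
    ((n : ℝ) + 1) * (n + 2) *
        (penalized f P.lam (S.step P lmo ghat (n + 1)).x (S.step P lmo ghat (n + 1)).x' - f x) ≤
      (n : ℝ) * (n + 1) * (penalized f P.lam S.x S.x' - f x)
      + 4 / P.lam * (‖S.z - x‖ ^ 2 - ‖(S.step P lmo ghat (n + 1)).z - x‖ ^ 2
        + (1 + slideExcess (P.T (n + 1)))
          * (‖S.z' - x‖ ^ 2 - ‖(S.step P lmo ghat (n + 1)).z' - x‖ ^ 2))
      + 2 * ((n : ℝ) + 1) * (P.η (n + 1)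
        + slideNoiseSum P S ghat sg (n + 1) (P.T (n + 1)) x) := by
  have hS' := hS.step ((norm_nonneg _).trans hS.2.2.1) hX hlmo ghat (k := n + 1) (by omega)
  have hR : 0 ≤ P.R := (norm_nonneg _).trans hS.2.2.1
  have hxR : ‖x‖ ≤ P.R := mem_closedBall_zero_iff.1 (hXR hx)
  have hKr : (0 : ℝ) < P.K := by exact_mod_cast hK
  have hβe : P.β (n + 1) = 4 / (P.lam * ((n : ℝ) + 1)) := by
    rw [MolesParams.β]; push_cast; rfl
  have hγe : P.γ (n + 1) = 2 / ((n : ℝ) + 2) := by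
    rw [MolesParams.γ]; push_cast; ring
  have hβ : 0 < P.β (n + 1) := by rw [hβe]; positivity
  have hγ0 : 0 < P.γ (n + 1) := by rw [hγe]; positivity
  have hγ1 : P.γ (n + 1) ≤ 1 := by
    rw [hγe, div_le_one (by positivity)]
    have : (0 : ℝ) ≤ n := by positivity
    linarith
  have hηe : P.η (n + 1) = 4 * P.c' * P.Dtilde / (P.lam * P.K * ((n : ℝ) + 1)) := by
    rw [MolesParams.η]; push_cast; rfl
  -- `That` is `7 * β * D ^ 2 / η` rounded up, in every outer iteration.
  have hfw : P.β (n + 1) * inner ℝ ((S.project P lmo (n + 1)).1 -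
      (S.z - (1 / P.β (n + 1)) • ((1 / P.lam) • (S.y P (n + 1) - S.y' P (n + 1)))))
      ((S.project P lmo (n + 1)).1 - x) ≤ P.η (n + 1) := by
    refine fwProjection_gap_le hX hlmo hD _ hβ ?_ (by rw [hηe]; positivity) hS.2.1 hx
    have h1 : 7 * P.K * P.D ^ 2 / (P.c' * P.Dtilde) ≤ (P.That : ℝ) := Nat.le_ceil _
    have h2 : 7 * (P.β (n + 1) * P.D ^ 2)
        = P.η (n + 1) * (7 * P.K * P.D ^ 2 / (P.c' * P.Dtilde)) := by
      rw [hηe, hβe]; field_simp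
    rw [h2]
    gcongr
    rw [hηe]; positivity
  have hps := proxSlide_bound hβ hf hLip ghat ((1 / P.lam) • (S.y' P (n + 1) - S.y P (n + 1)))
    hR hS.2.2.2 sg (P.T (n + 1)) (fun t ht => (hsg t ht).1) (fun t ht => (hsg t ht).2) hxR
  have hpen := penalty_extrapolation_le hlam hγ0.le hγ1 S.x S.x' S.z S.z'
    (S.project P lmo (n + 1)).1 (S.slide P ghat (n + 1) (P.T (n + 1))).avg
  have havgR : ‖(S.slide P ghat (n + 1) (P.T (n + 1))).avg‖ ≤ P.R :=
    proxSlide_avg_mem hR ghat _ hS.2.2.2 _ _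
  have hfc := hf.2 (mem_closedBall_zero_iff.2 hS.2.2.1) (mem_closedBall_zero_iff.2 havgR)
    (sub_nonneg.2 hγ1) hγ0.le (by ring)
  have ex : (S.step P lmo ghat (n + 1)).x =
    (1 - P.γ (n + 1)) • S.x + P.γ (n + 1) • (S.project P lmo (n + 1)).1 := rfl
  have ex' : (S.step P lmo ghat (n + 1)).x' = (1 - P.γ (n + 1)) • S.x'
    + P.γ (n + 1) • (S.slide P ghat (n + 1) (P.T (n + 1))).avg := rfl
  have ez : (S.step P lmo ghat (n + 1)).z = (S.project P lmo (n + 1)).1 := rfl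
  have ez' : (S.step P lmo ghat (n + 1)).z' = (S.slide P ghat (n + 1) (P.T (n + 1))).u := rfl
  have hnoise : ∑ t ∈ Finset.range (P.T (n + 1)),
      slideNoise P.G (P.β (n + 1)) t (ghat t - sg t) ((proxSlide P.R ghat
        ((1 / P.lam) • (S.y' P (n + 1) - S.y P (n + 1))) S.z' (P.β (n + 1)) t).u - x)
      = ∑ t ∈ Finset.range (P.T (n + 1)),
      slideNoise P.G (P.β (n + 1)) t (ghat t - sg t) ((S.slide P ghat (n + 1) t).u - x) := rfl
  rw [hnoise] at hps
  rw [ex, ex', ez, ez', penalized, penalized, slideNoiseSum]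
  change _ * (slideObj f _ S.z' _ (S.slide P ghat (n + 1) (P.T (n + 1))).avg - _) ≤ _ / 2 *
    (_ - _ * ‖x - (S.slide P ghat (n + 1) (P.T (n + 1))).u‖ ^ 2) + _ at hps
  generalize ∑ t ∈ Finset.range (P.T (n + 1)), slideNoise P.G (P.β (n + 1)) t (ghat t - sg t)
    ((S.slide P ghat (n + 1) t).u - x) = N at *
  -- Division by the total weight `T * (T + 3) / 2` of the averaged iterates.
  have hTr : (1 : ℝ) ≤ P.T (n + 1) := by exact_mod_cast hT
  have hps' := mul_le_mul_of_nonneg_left hps (slideExcess_nonneg (P.T (n + 1)))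
  have ea : ∀ A : ℝ, slideExcess (P.T (n + 1)) * ((P.T (n + 1) : ℝ) * (P.T (n + 1) + 3) / 2 * A)
      = A := by
    intro A
    rw [slideExcess]; field_simp
  have eb : slideExcess (P.T (n + 1)) * (((P.T (n + 1) : ℝ) + 1) * (P.T (n + 1) + 2) / 2)
      = 1 + slideExcess (P.T (n + 1)) := by
    rw [slideExcess]; field_simp; ring
  rw [ea, mul_add] at hps'
  have ec : ∀ A B : ℝ, slideExcess (P.T (n + 1)) * (P.β (n + 1) / 2 *
      (A - ((P.T (n + 1) : ℝ) + 1) * (P.T (n + 1) + 2) / 2 * B))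
      = P.β (n + 1) / 2 * (slideExcess (P.T (n + 1)) * A - (1 + slideExcess (P.T (n + 1))) * B) := by
    intro A B
    rw [← eb]; ring
  rw [ec] at hps'
  generalize slideExcess (P.T (n + 1)) = a at *
  have ew : (1 / P.lam) • (S.y' P (n + 1) - S.y P (n + 1))
      = -((1 / P.lam) • (S.y P (n + 1) - S.y' P (n + 1))) := by module
  rw [ew] at hps'
  change _ ≤ _ + P.γ (n + 1) * inner ℝ ((1 / P.lam) • (S.y P (n + 1) - S.y' P (n + 1))) _ + _
    at hpen
  generalize (1 / P.lam) • (S.y P (n + 1) - S.y' P (n + 1)) = w at *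
  generalize (S.project P lmo (n + 1)).1 = p at *
  generalize (S.slide P ghat (n + 1) (P.T (n + 1))).avg = q at *
  generalize (S.slide P ghat (n + 1) (P.T (n + 1))).u = v at *
  have efw : P.β (n + 1) * inner ℝ (p - (S.z - (1 / P.β (n + 1)) • w)) (p - x)
      = inner ℝ w (p - x) + P.β (n + 1) * inner ℝ (p - S.z) (p - x) := by
    have : p - (S.z - (1 / P.β (n + 1)) • w) = (1 / P.β (n + 1)) • w + (p - S.z) := by abel
    rw [this, inner_add_left, real_inner_smul_left]
    field_simp
  rw [efw] at hfw
  have hpar : ‖S.z - x‖ ^ 2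
      = ‖p - S.z‖ ^ 2 - 2 * inner ℝ (p - S.z) (p - x) + ‖p - x‖ ^ 2 := by
    rw [← norm_sub_sq_real, norm_sub_rev]
    congr 2
    abel
  have hsm : P.γ (n + 1) ^ 2 / P.lam ≤ P.γ (n + 1) * P.β (n + 1) / 2 := by
    rw [hβe, hγe, div_pow, div_div, div_mul_div_comm, div_div,
      div_le_div_iff₀ (by positivity) (by positivity)]
    have : 0 ≤ P.lam * ((n : ℝ) + 2) := by positivity
    nlinarith
  have hsm' := mul_le_mul_of_nonneg_right hsm
    (by positivity : 0 ≤ ‖p - S.z‖ ^ 2 + ‖q - S.z'‖ ^ 2)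
  have hmain := mul_le_mul_of_nonneg_left (add_le_add hps' hfw) hγ0.le
  simp only [slideObj, inner_neg_left, inner_sub_right, norm_sub_rev x] at hmain hpen hpar hsm'
  rw [smul_eq_mul, smul_eq_mul] at hfc
  have e1 : ((n : ℝ) + 1) * (n + 2) * (1 - P.γ (n + 1)) = n * (n + 1) := by
    rw [hγe]; field_simp; ring
  have e2 : ((n : ℝ) + 1) * (n + 2) * P.γ (n + 1) = 2 * (n + 1) := by
    rw [hγe]; field_simp
  have e3 : 2 * ((n : ℝ) + 1) * (P.β (n + 1) / 2) = 4 / P.lam := by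
    rw [hβe]; field_simp
  rw [← e1, ← e2, ← e3, ← e2]
  have hw0 : (0 : ℝ) ≤ (n + 1) * (n + 2) := by positivity
  have hmul : f ((1 - P.γ (n + 1)) • S.x' + P.γ (n + 1) • q)
      + ‖(1 - P.γ (n + 1)) • S.x + P.γ (n + 1) • p
        - ((1 - P.γ (n + 1)) • S.x' + P.γ (n + 1) • q)‖ ^ 2 / (2 * P.lam) - f x ≤
      (1 - P.γ (n + 1)) * (f S.x' + ‖S.x - S.x'‖ ^ 2 / (2 * P.lam) - f x)
      + P.γ (n + 1) * (P.β (n + 1) / 2) * (‖S.z - x‖ ^ 2 - ‖p - x‖ ^ 2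
        + (1 + a) * (‖S.z' - x‖ ^ 2 - ‖v - x‖ ^ 2)) + P.γ (n + 1) * (P.η (n + 1) + a * N) := by
    rw [hpar]
    linarith
  calc _ ≤ _ := mul_le_mul_of_nonneg_left hmul hw0
    _ = _ := by ring

/-- **Pathwise guarantee of MOLES.** The numbers of Prox-Slide steps are nondecreasing in the outer
iteration, hence the excess weights are nonincreasing and the distances to `x` telescope. -/
theorem moles_bound {P : MolesParams} {X : Set E} (hX : Convex ℝ X)
    (hXR : X ⊆ Metric.closedBall 0 P.R) {lmo : E → E} (hlmo : IsLMO X lmo)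
    (hD : ∀ a ∈ X, ∀ b ∈ X, ‖a - b‖ ≤ P.D) {f : E → ℝ}
    (hf : ConvexOn ℝ (Metric.closedBall 0 P.R) f)
    (hLip : ∀ x ∈ Metric.closedBall (0 : E) P.R, ∀ y ∈ Metric.closedBall (0 : E) P.R,
      |f y - f x| ≤ P.G * ‖y - x‖)
    (hlam : 0 < P.lam) (hDt : 0 < P.Dtilde) (hc' : 0 < P.c') (hG : 0 < P.G)
    {x₀ : E} (hx₀ : x₀ ∈ X) (ghat sg : ℕ → ℕ → E) {x : E} (hx : x ∈ X) (k : ℕ) (hk : k ≤ P.K)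
    (hsg : ∀ j < k, ∀ t < P.T (j + 1), IsSubgradientOn f (Metric.closedBall 0 P.R)
      (molesQuery P lmo x₀ ghat j t) (sg (j + 1) t) ∧ ‖sg (j + 1) t‖ ≤ P.G) :
    (k : ℝ) * (k + 1) * (penalized f P.lam (moles P lmo x₀ ghat k).x (moles P lmo x₀ ghat k).x'
        - f x) ≤
      10 / P.lam * ‖x₀ - x‖ ^ 2 + ∑ j ∈ Finset.range k, 2 * ((j : ℝ) + 1) * (P.η (j + 1)
        + slideNoiseSum P (moles P lmo x₀ ghat j) (ghat (j + 1)) (sg (j + 1)) (j + 1)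
          (P.T (j + 1)) x) := by
  rcases Nat.eq_zero_or_pos P.K with hK | hK
  · obtain rfl : k = 0 := by omega
    simp
    positivity
  have hKr : (0 : ℝ) < P.K := by exact_mod_cast hK
  have hT : ∀ j, 1 ≤ P.T (j + 1) := by
    intro j
    rw [MolesParams.T, Nat.one_le_ceil_iff]
    positivity
  have hTmono : ∀ j, P.T (j + 1) ≤ P.T (j + 2) := by
    intro j
    rw [MolesParams.T, MolesParams.T]
    gcongr
    omega
  -- The last distance carries the excess weight of the coming iteration, which may be smaller.
  have key : ∀ i ≤ k, (i : ℝ) * (i + 1) *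
      (penalized f P.lam (moles P lmo x₀ ghat i).x (moles P lmo x₀ ghat i).x' - f x) ≤
      4 / P.lam * (‖x₀ - x‖ ^ 2 - ‖(moles P lmo x₀ ghat i).z - x‖ ^ 2
        + (1 + slideExcess (P.T 1)) * ‖x₀ - x‖ ^ 2
        - (1 + slideExcess (P.T (i + 1))) * ‖(moles P lmo x₀ ghat i).z' - x‖ ^ 2)
      + ∑ j ∈ Finset.range i, 2 * ((j : ℝ) + 1) * (P.η (j + 1)
        + slideNoiseSum P (moles P lmo x₀ ghat j) (ghat (j + 1)) (sg (j + 1)) (j + 1)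
          (P.T (j + 1)) x) := by
    intro i
    induction i with
    | zero => intro _; simp [moles]
    | succ i ih =>
      intro hi
      have h1 := ih (by omega)
      have h2 := moles_step_bound hX hXR hlmo hD hf hLip hlam hDt hc' hK
        (moles_feasible hX hXR hlmo hx₀ ghat i) i (hT i) (ghat (i + 1)) (sg (i + 1))
        (hsg i (by omega)) hx
      change _ * _ * (penalized f P.lam (moles P lmo x₀ ghat (i + 1)).x
        (moles P lmo x₀ ghat (i + 1)).x' - f x) ≤ _ + 4 / P.lam * (_ -
        ‖(moles P lmo x₀ ghat (i + 1)).z - x‖ ^ 2 + _ * (_ -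
        ‖(moles P lmo x₀ ghat (i + 1)).z' - x‖ ^ 2)) + _ at h2
      have h3 : 4 / P.lam * ((1 + slideExcess (P.T (i + 1 + 1)))
          * ‖(moles P lmo x₀ ghat (i + 1)).z' - x‖ ^ 2) ≤
          4 / P.lam * ((1 + slideExcess (P.T (i + 1)))
          * ‖(moles P lmo x₀ ghat (i + 1)).z' - x‖ ^ 2) := by
        have := slideExcess_anti (hT i) (hTmono i)
        gcongr
      rw [Finset.sum_range_succ]
      push_cast
      have e : (i : ℝ) + 1 + 1 = i + 2 := by ring
      rw [e]
      linarith
  refine (key k le_rfl).trans (add_le_add_left ?_ _)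
  have h1 := slideExcess_le (hT 0)
  have h2 : 0 ≤ (1 + slideExcess (P.T (k + 1))) * ‖(moles P lmo x₀ ghat k).z' - x‖ ^ 2 :=
    mul_nonneg (by linarith [slideExcess_nonneg (P.T (k + 1))]) (sq_nonneg _)
  have h3 : slideExcess (P.T (0 + 1)) * ‖x₀ - x‖ ^ 2 ≤ 1 / 2 * ‖x₀ - x‖ ^ 2 := by gcongr
  calc _ ≤ 4 / P.lam * (5 / 2 * ‖x₀ - x‖ ^ 2) := by
        gcongr
        linarith [sq_nonneg ‖(moles P lmo x₀ ghat k).z - x‖]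
    _ = _ := by ring

end MolesBound

/-! ### Measurability of the iterates -/

section MolesMeasurable

variable {E : Type*} [NormedAddCommGroup E] [InnerProductSpace ℝ E] [MeasurableSpace E]
  [BorelSpace E] [SecondCountableTopology E] {Ω : Type*} [MeasurableSpace Ω]

theorem measurable_fwProjection {lmo : E → E} (hlmo : Measurable lmo) (β η : ℝ) (n t : ℕ)
    {z u : Ω → E} (hz : Measurable z) (hu : Measurable u) :
    Measurable fun ω => (fwProjection lmo (z ω) β η n t (u ω)).1 := by
  induction n generalizing t u with
  | zero => exact hu
  | succ n ih =>
    have hs : Measurable fun ω => lmo (u ω - z ω) := hlmo.comp (hu.sub hz)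
    have hstep : Measurable fun ω => fwStep lmo (z ω) t (u ω) := by
      unfold fwStep
      fun_prop
    have hset : MeasurableSet
        {ω | β * inner ℝ (u ω - z ω) (u ω - lmo (u ω - z ω)) ≤ η} :=
      measurableSet_le (((hu.sub hz).inner (hu.sub hs)).const_mul β) measurable_const
    have e : (fun ω => (fwProjection lmo (z ω) β η (n + 1) t (u ω)).1) = fun ω =>
        if β * inner ℝ (u ω - z ω) (u ω - lmo (u ω - z ω)) ≤ η then u ω
        else (fwProjection lmo (z ω) β η n (t + 1) (fwStep lmo (z ω) t (u ω))).1 := by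
      funext ω
      rw [fwProjection]
      split_ifs <;> rfl
    rw [e]
    exact Measurable.ite hset hu (ih _ hstep)

theorem measurable_projBall (R : ℝ) : Measurable (projBall R : E → E) := by
  unfold projBall
  fun_prop

theorem measurable_proxSlide (R β : ℝ) {ghat : ℕ → Ω → E} {g u₀ : Ω → E} (hg : Measurable g)
    (hu₀ : Measurable u₀) (n : ℕ) (hghat : ∀ t < n, Measurable (ghat t)) :
    (Measurable fun ω => (proxSlide R (fun t => ghat t ω) (g ω) (u₀ ω) β n).u) ∧
      Measurable fun ω => (proxSlide R (fun t => ghat t ω) (g ω) (u₀ ω) β n).avg := by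
  induction n with
  | zero => exact ⟨hu₀, hu₀⟩
  | succ n ih =>
    obtain ⟨h1, h2⟩ := ih (fun t ht => hghat t (by omega))
    have h3 := hghat n (by omega)
    have h4 : Measurable fun ω => (proxSlide R (fun t => ghat t ω) (g ω) (u₀ ω) β (n + 1)).u := by
      refine (measurable_projBall R).comp ?_
      fun_prop
    refine ⟨h4, ?_⟩
    exact (h2.const_smul _).add (h4.const_smul _)

theorem measurable_moles (P : MolesParams) {lmo : E → E} (hlmo : Measurable lmo) (x₀ : E)
    {ghat : ℕ → ℕ → Ω → E} (k : ℕ)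
    (hghat : ∀ j < k, ∀ t < P.T (j + 1), Measurable (ghat (j + 1) t)) :
    (Measurable fun ω => (moles P lmo x₀ (fun i j => ghat i j ω) k).x) ∧
      (Measurable fun ω => (moles P lmo x₀ (fun i j => ghat i j ω) k).x') ∧
      (Measurable fun ω => (moles P lmo x₀ (fun i j => ghat i j ω) k).z) ∧
      Measurable fun ω => (moles P lmo x₀ (fun i j => ghat i j ω) k).z' := by
  induction k with
  | zero => exact ⟨measurable_const, measurable_const, measurable_const, measurable_const⟩
  | succ k ih =>
    obtain ⟨hx, hx', hz, hz'⟩ := ih (fun j hj => hghat j (by omega))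
    have hy : Measurable fun ω => (moles P lmo x₀ (fun i j => ghat i j ω) k).y P (k + 1) :=
      (hx.const_smul _).add (hz.const_smul _)
    have hy' : Measurable fun ω => (moles P lmo x₀ (fun i j => ghat i j ω) k).y' P (k + 1) :=
      (hx'.const_smul _).add (hz'.const_smul _)
    have hp : Measurable fun ω =>
        ((moles P lmo x₀ (fun i j => ghat i j ω) k).project P lmo (k + 1)).1 :=
      measurable_fwProjection hlmo _ _ _ _
        (hz.sub (((hy.sub hy').const_smul (1 / P.lam)).const_smul (1 / P.β (k + 1)))) hz
    have hq := measurable_proxSlide P.R (P.β (k + 1)) ((hy'.sub hy).const_smul (1 / P.lam)) hz'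
      (P.T (k + 1)) (hghat k (by omega))
    exact ⟨(hx.const_smul _).add (hp.const_smul _), (hx'.const_smul _).add (hq.2.const_smul _),
      hp, hq.1⟩

end MolesMeasurable

/-! ### Expected error of the oracle answers -/

section Noise

variable {E : Type*} [NormedAddCommGroup E] [InnerProductSpace ℝ E] [MeasurableSpace E]
  [BorelSpace E] [SecondCountableTopology E] [CompleteSpace E] {Ω : Type*} [mΩ : MeasurableSpace Ω]

/-- The two moments of the error of an oracle answer: its mean square is at most `σ ^ 2`, and it is
orthogonal in mean to the difference of the bounded query point and a fixed point. -/
theorem IsSFOAnswer.exists_subgradient {μ : Measure Ω} [IsProbabilityMeasure μ] {f : E → ℝ}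
    {S : Set E} {G σ R : ℝ} {u ghat : Ω → E} (h : IsSFOAnswer μ f S G σ u ghat)
    (hu : ∀ ω, ‖u ω‖ ≤ R) (x : E) :
    ∃ g : Ω → E, (∀ᵐ ω ∂μ, IsSubgradientOn f S (u ω) (g ω) ∧ ‖g ω‖ ≤ G) ∧
      Integrable (fun ω => ‖ghat ω - g ω‖ ^ 2) μ ∧ ∫ ω, ‖ghat ω - g ω‖ ^ 2 ∂μ ≤ σ ^ 2 ∧
      Integrable (fun ω => ‖ghat ω - g ω‖) μ ∧
      Integrable (fun ω => inner ℝ (ghat ω - g ω) (u ω - x)) μ ∧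
      ∫ ω, inner ℝ (ghat ω - g ω) (u ω - x) ∂μ = 0 := by
  obtain ⟨-, hL2, m, g, hm, hum, hgm, hsub, hmean, hvar⟩ := h
  have hgL : MemLp g 2 μ := MemLp.of_bound (hgm.mono hm).aestronglyMeasurable G
    (hsub.mono fun ω h => h.2)
  have hδ : MemLp (fun ω => ghat ω - g ω) 2 μ := hL2.sub hgL
  have hδ1 : Integrable (fun ω => ghat ω - g ω) μ := hδ.integrable (by norm_num)
  have hδ2 : Integrable (fun ω => ‖ghat ω - g ω‖ ^ 2) μ := hδ.integrable_norm_pow (by norm_num)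
  have hvm : StronglyMeasurable[m] fun ω => u ω - x :=
    hum.stronglyMeasurable.sub stronglyMeasurable_const
  have hin : Integrable (fun ω => inner ℝ (ghat ω - g ω) (u ω - x)) μ := by
    refine Integrable.mono' (hδ1.norm.mul_const (R + ‖x‖))
      (hδ1.aestronglyMeasurable.inner (hvm.mono hm).aestronglyMeasurable) (ae_of_all _ fun ω => ?_)
    refine (norm_inner_le_norm _ _).trans ?_
    gcongr
    exact (norm_sub_le _ _).trans (by gcongr; exact hu ω)
  refine ⟨g, hsub, hδ2, ?_, hδ1.norm, hin, ?_⟩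
  · rw [← integral_condExp hm]
    calc _ ≤ ∫ _, σ ^ 2 ∂μ := integral_mono_ae integrable_condExp (integrable_const _) hvar
      _ = _ := by simp
  · rw [← integral_condExp hm]
    have h1 := condExp_bilin_of_stronglyMeasurable_right (innerSL ℝ) hvm hin hδ1
    have h2 := condExp_sub (hL2.integrable (by norm_num)) (hgL.integrable (by norm_num)) m
    have h3 := condExp_of_stronglyMeasurable hm hgm (hgL.integrable (by norm_num))
    have h4 : (fun ω => inner ℝ (μ[fun ω => ghat ω - g ω | m] ω) (u ω - x)) =ᵐ[μ] 0 := by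
      filter_upwards [h2, hmean] with ω h2 h5
      have : μ[fun ω => ghat ω - g ω | m] ω = 0 := by
        refine h2.trans ?_
        rw [Pi.sub_apply, h5, h3, sub_self]
      simp [this]
    exact (integral_congr_ae (h1.trans h4)).trans (by simp)

/-- The expected error contribution of one oracle answer. -/
theorem IsSFOAnswer.exists_slideNoise_le {μ : Measure Ω} [IsProbabilityMeasure μ] {f : E → ℝ}
    {S : Set E} {G σ R β : ℝ} (hβ : 0 < β) {u ghat : Ω → E} (h : IsSFOAnswer μ f S G σ u ghat)
    (hu : ∀ ω, ‖u ω‖ ≤ R) (x : E) (t : ℕ) :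
    ∃ g : Ω → E, (∀ᵐ ω ∂μ, IsSubgradientOn f S (u ω) (g ω) ∧ ‖g ω‖ ≤ G) ∧
      Integrable (fun ω => slideNoise G β t (ghat ω - g ω) (u ω - x)) μ ∧
      ∫ ω, slideNoise G β t (ghat ω - g ω) (u ω - x) ∂μ ≤ 4 * (4 * G ^ 2 + σ ^ 2) / β := by
  obtain ⟨g, hsub, h2, h2le, h1, hin, hin0⟩ := h.exists_subgradient hu x
  have hsq : Integrable (fun ω => (2 * G + ‖ghat ω - g ω‖) ^ 2) μ := by
    have e : (fun ω => (2 * G + ‖ghat ω - g ω‖) ^ 2) = fun ω =>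
        4 * G ^ 2 + 4 * G * ‖ghat ω - g ω‖ + ‖ghat ω - g ω‖ ^ 2 := by
      funext ω; ring
    rw [e]
    exact ((integrable_const _).add (h1.const_mul _)).add h2
  have hsqle : ∫ ω, (2 * G + ‖ghat ω - g ω‖) ^ 2 ∂μ ≤ 8 * G ^ 2 + 2 * σ ^ 2 := by
    calc _ ≤ ∫ ω, (8 * G ^ 2 + 2 * ‖ghat ω - g ω‖ ^ 2) ∂μ := by
          refine integral_mono hsq ((integrable_const _).add (h2.const_mul _)) fun ω => ?_
          show (2 * G + ‖ghat ω - g ω‖) ^ 2 ≤ 8 * G ^ 2 + 2 * ‖ghat ω - g ω‖ ^ 2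
          nlinarith [sq_nonneg (2 * G - ‖ghat ω - g ω‖)]
      _ = 8 * G ^ 2 + 2 * ∫ ω, ‖ghat ω - g ω‖ ^ 2 ∂μ := by
          rw [integral_add (integrable_const _) (h2.const_mul _)]
          simp [integral_const_mul]
      _ ≤ _ := by gcongr
  refine ⟨g, hsub, ((hsq.div_const _).sub hin).const_mul _, ?_⟩
  simp only [slideNoise]
  rw [integral_const_mul, integral_sub (hsq.div_const _) hin, hin0, sub_zero, integral_div]
  calc ((t : ℝ) + 2) * ((∫ ω, (2 * G + ‖ghat ω - g ω‖) ^ 2 ∂μ) / (β * ((t : ℝ) + 1)))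
      ≤ ((t : ℝ) + 2) * ((8 * G ^ 2 + 2 * σ ^ 2) / (β * ((t : ℝ) + 1))) := by gcongr
    _ ≤ (2 * ((t : ℝ) + 1)) * ((8 * G ^ 2 + 2 * σ ^ 2) / (β * ((t : ℝ) + 1))) := by
        gcongr
        linarith [(Nat.cast_nonneg t : (0 : ℝ) ≤ t)]
    _ = _ := by field_simp; ring

end Noise

/-! ### From the penalized objective to the objective -/

section Lipschitz

variable {E : Type*} [NormedAddCommGroup E]

/-- Replacing `x'` by `x` costs at most the penalty and half of `lam * G ^ 2`. -/
theorem le_penalized_add {f : E → ℝ} {R G lam : ℝ} (hlam : 0 < lam)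
    (hLip : ∀ x ∈ Metric.closedBall (0 : E) R, ∀ y ∈ Metric.closedBall (0 : E) R,
      |f y - f x| ≤ G * ‖y - x‖) {x x' : E} (hx : ‖x‖ ≤ R) (hx' : ‖x'‖ ≤ R) :
    f x ≤ penalized f lam x x' + lam * G ^ 2 / 2 := by
  have h1 := (abs_le.1 (hLip x' (mem_closedBall_zero_iff.2 hx') x (mem_closedBall_zero_iff.2 hx))).2
  have h2 : 0 ≤ (‖x - x'‖ - lam * G) ^ 2 / (2 * lam) := by positivity
  have h3 : (‖x - x'‖ - lam * G) ^ 2 / (2 * lam)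
      = ‖x - x'‖ ^ 2 / (2 * lam) + lam * G ^ 2 / 2 - G * ‖x - x'‖ := by
    field_simp; ring
  rw [penalized]
  linarith

theorem integrable_comp_of_lipschitz_ball [MeasurableSpace E] [BorelSpace E]
    {Ω : Type*} [MeasurableSpace Ω] {f : E → ℝ} {R G : ℝ} (hG : 0 ≤ G)
    (hLip : ∀ x ∈ Metric.closedBall (0 : E) R, ∀ y ∈ Metric.closedBall (0 : E) R,
      |f y - f x| ≤ G * ‖y - x‖) {μ : Measure Ω} [IsFiniteMeasure μ] {u : Ω → E}
    (hu : Measurable u) (huR : ∀ ω, ‖u ω‖ ≤ R) : Integrable (fun ω => f (u ω)) μ := by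
  lift G to NNReal using hG
  have hL : LipschitzOnWith G f (Metric.closedBall 0 R) :=
    LipschitzOnWith.of_dist_le_mul fun x hx y hy => by
      rw [Real.dist_eq, dist_eq_norm]
      exact hLip y hy x hx
  -- Outside the ball `f` need not be measurable, hence the Lipschitz extension.
  obtain ⟨F, hF, hEq⟩ := hL.extend_real
  have e : (fun ω => f (u ω)) = fun ω => F (u ω) := by
    funext ω
    exact hEq (mem_closedBall_zero_iff.2 (huR ω))
  rw [e]
  refine Integrable.of_bound (hF.continuous.measurable.comp hu).aestronglyMeasurable
    (‖F 0‖ + G * R) (ae_of_all _ fun ω => ?_)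
  have h1 := hF.dist_le_mul (u ω) 0
  rw [dist_zero_right, dist_eq_norm] at h1
  have h2 : G * ‖u ω‖ ≤ G * R := by gcongr; exact huR ω
  have h3 := norm_sub_norm_le (F (u ω)) (F 0)
  linarith

end Lipschitz

/-! ### The expected guarantee -/

/-- The number of Prox-Slide steps is chosen to make the expected error of a run, which is the left
side, of the same order as the error of the approximate projections. -/
theorem slideExcess_mul_le {P : MolesParams} (hlam : 0 < P.lam) (hDt : 0 < P.Dtilde)
    (hK : 0 < P.K) (hG : 0 < P.G) (n : ℕ) :
    slideExcess (P.T (n + 1)) * (P.T (n + 1) * (4 * (4 * P.G ^ 2 + P.σ ^ 2) / P.β (n + 1))) ≤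
      4 * P.Dtilde / (P.lam * P.K * ((n : ℝ) + 1)) := by
  have hKr : (0 : ℝ) < P.K := by exact_mod_cast hK
  have h1 : (4 * P.G ^ 2 + P.σ ^ 2) * P.lam ^ 2 * P.K * ((n : ℝ) + 1) ^ 2 / (2 * P.Dtilde)
      ≤ P.T (n + 1) := by
    have := Nat.le_ceil
      ((4 * P.G ^ 2 + P.σ ^ 2) * P.lam ^ 2 * P.K * ((n + 1 : ℕ) : ℝ) ^ 2 / (2 * P.Dtilde))
    push_cast at this
    rw [MolesParams.T]
    push_cast
    exact this
  have hM : 0 < 4 * P.G ^ 2 + P.σ ^ 2 := by positivity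
  have hT : 0 < (P.T (n + 1) : ℝ) := lt_of_lt_of_le (by positivity) h1
  have hβe : P.β (n + 1) = 4 / (P.lam * ((n : ℝ) + 1)) := by
    rw [MolesParams.β]; push_cast; rfl
  rw [hβe, slideExcess]
  rw [div_le_iff₀ (by positivity)] at h1
  generalize 4 * P.G ^ 2 + P.σ ^ 2 = M at *
  generalize (P.T (n + 1) : ℝ) = T at *
  have e : 2 / (T * (T + 3)) * (T * (4 * M / (4 / (P.lam * ((n : ℝ) + 1)))))
      = 2 * M * P.lam * (n + 1) / (T + 3) := by
    field_simp
  rw [e, div_le_div_iff₀ (by positivity) (by positivity)]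
  linarith

section Guarantee

variable {E : Type*} [NormedAddCommGroup E] [InnerProductSpace ℝ E]

theorem moles_lmoCalls_le (P : MolesParams) (lmo : E → E) (x₀ : E) (ghat : ℕ → ℕ → E) (k : ℕ) :
    (moles P lmo x₀ ghat k).lmoCalls ≤ k * P.That := by
  induction k with
  | zero => simp [moles]
  | succ k ih =>
    rw [Nat.succ_mul]
    exact Nat.add_le_add ih (fwProjection_calls_le _ _ _ _ _ _ _)

theorem moles_sfoCalls (P : MolesParams) (lmo : E → E) (x₀ : E) (ghat : ℕ → ℕ → E) (k : ℕ) :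
    (moles P lmo x₀ ghat k).sfoCalls = ∑ j ∈ Finset.range k, P.T (j + 1) := by
  induction k with
  | zero => simp [moles]
  | succ k ih =>
    rw [Finset.sum_range_succ, ← ih]
    exact congrArg _ (proxSlide_sfoCalls _ _ _ _ _ _)

variable [MeasurableSpace E] [BorelSpace E] [SecondCountableTopology E] [CompleteSpace E]
  {Ω : Type*} [MeasurableSpace Ω]

/-- **Expected suboptimality of MOLES**, for general inputs. -/
theorem moles_expected_le {P : MolesParams} {X : Set E} (hX : Convex ℝ X)
    (hXR : X ⊆ Metric.closedBall 0 P.R) {lmo : E → E} (hlmo : IsLMO X lmo)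
    (hlmom : Measurable lmo)
    (hD : ∀ a ∈ X, ∀ b ∈ X, ‖a - b‖ ≤ P.D) {f : E → ℝ}
    (hf : ConvexOn ℝ (Metric.closedBall 0 P.R) f)
    (hLip : ∀ x ∈ Metric.closedBall (0 : E) P.R, ∀ y ∈ Metric.closedBall (0 : E) P.R,
      |f y - f x| ≤ P.G * ‖y - x‖)
    (hlam : 0 < P.lam) (hDt : 0 < P.Dtilde) (hc' : 0 < P.c') (hG : 0 < P.G) (hK : 0 < P.K)
    {x₀ : E} (hx₀ : x₀ ∈ X) {μ : Measure Ω} [IsProbabilityMeasure μ] {ghat : ℕ → ℕ → Ω → E}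
    {x : E} (hx : x ∈ X)
    (hsfo : ∀ k < P.K, ∀ t < P.T (k + 1),
      IsSFOAnswer μ f (Metric.closedBall 0 P.R) P.G P.σ
        (fun ω => molesQuery P lmo x₀ (fun i j => ghat i j ω) k t) (ghat (k + 1) t)) :
    Integrable (fun ω => f (moles P lmo x₀ (fun i j => ghat i j ω) P.K).x) μ ∧
      ∫ ω, f (moles P lmo x₀ (fun i j => ghat i j ω) P.K).x ∂μ - f x ≤
        (10 * ‖x₀ - x‖ ^ 2 + 8 * (1 + P.c') * P.Dtilde) / (P.lam * P.K ^ 2)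
          + P.lam * P.G ^ 2 / 2 := by
  have hKr : (0 : ℝ) < P.K := by exact_mod_cast hK
  have hfeas := fun k ω => moles_feasible hX hXR hlmo hx₀ (fun i j => ghat i j ω) k
  have hR : 0 ≤ P.R := (norm_nonneg _).trans (mem_closedBall_zero_iff.1 (hXR hx₀))
  have hint : Integrable (fun ω => f (moles P lmo x₀ (fun i j => ghat i j ω) P.K).x) μ :=
    integrable_comp_of_lipschitz_ball hG.le hLip
      (measurable_moles P hlmom x₀ P.K fun j hj t ht => (hsfo j hj t ht).1).1
      fun ω => mem_closedBall_zero_iff.1 (hXR (hfeas _ ω).1)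
  refine ⟨hint, ?_⟩
  have hq : ∀ k t ω, ‖molesQuery P lmo x₀ (fun i j => ghat i j ω) k t‖ ≤ P.R :=
    fun k t ω => proxSlide_u_mem hR _ _ (hfeas k ω).2.2.2 _ _
  have hβ : ∀ k, 0 < P.β (k + 1) := by
    intro k
    rw [MolesParams.β]
    positivity
  choose! sg hsub hnint hnle using fun k (hk : k < P.K) t (ht : t < P.T (k + 1)) =>
    (hsfo k hk t ht).exists_slideNoise_le (hβ k) (hq k t) x t
  obtain ⟨N, hN⟩ : ∃ N : ℕ → Ω → ℝ, N = fun k ω => slideNoiseSum P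
      (moles P lmo x₀ (fun i j => ghat i j ω) k) (fun t => ghat (k + 1) t ω) (fun t => sg k t ω)
      (k + 1) (P.T (k + 1)) x := ⟨_, rfl⟩
  have hNint : ∀ k < P.K, Integrable (N k) μ := by
    intro k hk
    rw [hN]
    refine Integrable.const_mul (integrable_finsetSum _ fun t ht => ?_) _
    exact hnint k hk t (Finset.mem_range.1 ht)
  have hNle : ∀ k < P.K, ∫ ω, N k ω ∂μ ≤ 4 * P.Dtilde / (P.lam * P.K * ((k : ℝ) + 1)) := by
    intro k hk
    refine le_trans ?_ (slideExcess_mul_le hlam hDt hK hG k)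
    have e : ∀ ω, N k ω = slideExcess (P.T (k + 1)) * ∑ t ∈ Finset.range (P.T (k + 1)),
        slideNoise P.G (P.β (k + 1)) t (ghat (k + 1) t ω - sg k t ω)
          (molesQuery P lmo x₀ (fun i j => ghat i j ω) k t - x) := fun ω => by rw [hN]; rfl
    simp only [e]
    rw [integral_const_mul, integral_finsetSum _ fun t ht => hnint k hk t (Finset.mem_range.1 ht)]
    refine mul_le_mul_of_nonneg_left ?_ (slideExcess_nonneg _)
    refine (Finset.sum_le_card_nsmul _ _ _ fun t ht =>
      hnle k hk t (Finset.mem_range.1 ht)).trans ?_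
    rw [Finset.card_range, nsmul_eq_mul]
  have hae : ∀ᵐ ω ∂μ, ∀ k < P.K, ∀ t < P.T (k + 1),
      IsSubgradientOn f (Metric.closedBall 0 P.R)
        (molesQuery P lmo x₀ (fun i j => ghat i j ω) k t) (sg k t ω) ∧ ‖sg k t ω‖ ≤ P.G := by
    simp only [ae_all_iff]
    exact hsub
  have hpath : ∀ᵐ ω ∂μ, f (moles P lmo x₀ (fun i j => ghat i j ω) P.K).x ≤
      (10 / P.lam * ‖x₀ - x‖ ^ 2 + ∑ j ∈ Finset.range P.K, 2 * ((j : ℝ) + 1) *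
        (P.η (j + 1) + N j ω)) / ((P.K : ℝ) * (P.K + 1)) + (f x + P.lam * P.G ^ 2 / 2) := by
    filter_upwards [hae] with ω hω
    have h1 := moles_bound hX hXR hlmo hD hf hLip hlam hDt hc' hG hx₀ (fun i j => ghat i j ω)
      (fun i j => sg (i - 1) j ω) hx P.K le_rfl hω
    have h2 := le_penalized_add hlam hLip
      (mem_closedBall_zero_iff.1 (hXR (hfeas P.K ω).1)) (hfeas P.K ω).2.2.1
    have h3 : (moles P lmo x₀ (fun i j => ghat i j ω) P.K).Feasible X P.R := hfeas P.K ω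
    rw [mul_comm, ← le_div_iff₀ (by positivity)] at h1
    simp only [Nat.add_sub_cancel] at h1
    rw [hN]
    linarith
  have hjint : ∀ j ∈ Finset.range P.K,
      Integrable (fun ω => 2 * ((j : ℝ) + 1) * (P.η (j + 1) + N j ω)) μ := fun j hj =>
    ((integrable_const _).add (hNint j (Finset.mem_range.1 hj))).const_mul _
  have hSint : Integrable (fun ω => ∑ j ∈ Finset.range P.K, 2 * ((j : ℝ) + 1) *
        (P.η (j + 1) + N j ω)) μ := integrable_finsetSum _ hjint
  have hSint' : Integrable (fun ω => (10 / P.lam * ‖x₀ - x‖ ^ 2 + ∑ j ∈ Finset.range P.K,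
      2 * ((j : ℝ) + 1) * (P.η (j + 1) + N j ω)) / ((P.K : ℝ) * (P.K + 1))) μ :=
    ((integrable_const _).add hSint).div_const _
  have hSle : ∫ ω, ∑ j ∈ Finset.range P.K, 2 * ((j : ℝ) + 1) * (P.η (j + 1) + N j ω) ∂μ
      ≤ 8 * (1 + P.c') * P.Dtilde / P.lam := by
    rw [integral_finsetSum _ hjint]
    refine (Finset.sum_le_card_nsmul _ _ (8 * (1 + P.c') * P.Dtilde / (P.lam * P.K))
      fun j hj => ?_).trans ?_
    · have hj' := Finset.mem_range.1 hj
      rw [integral_const_mul, integral_add (integrable_const _) (hNint j hj')]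
      have h1 : P.η (j + 1) = 4 * P.c' * P.Dtilde / (P.lam * P.K * ((j : ℝ) + 1)) := by
        rw [MolesParams.η]; push_cast; rfl
      have h2 := hNle j hj'
      have h3 : ∫ _ : Ω, P.η (j + 1) ∂μ = P.η (j + 1) := by simp
      rw [h3, h1]
      calc _ ≤ 2 * ((j : ℝ) + 1) * (4 * P.c' * P.Dtilde / (P.lam * P.K * ((j : ℝ) + 1))
            + 4 * P.Dtilde / (P.lam * P.K * ((j : ℝ) + 1))) := by gcongr
        _ = _ := by field_simp; ring
    · rw [Finset.card_range, nsmul_eq_mul]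
      apply le_of_eq
      field_simp
  have hfin := integral_mono_ae hint
    (hSint'.add (integrable_const (f x + P.lam * P.G ^ 2 / 2))) hpath
  have hcalc : ∫ ω, ((10 / P.lam * ‖x₀ - x‖ ^ 2 + ∑ j ∈ Finset.range P.K, 2 * ((j : ℝ) + 1) *
        (P.η (j + 1) + N j ω)) / ((P.K : ℝ) * (P.K + 1)) + (f x + P.lam * P.G ^ 2 / 2)) ∂μ
      = (10 / P.lam * ‖x₀ - x‖ ^ 2 + ∫ ω, ∑ j ∈ Finset.range P.K, 2 * ((j : ℝ) + 1) *
        (P.η (j + 1) + N j ω) ∂μ) / ((P.K : ℝ) * (P.K + 1)) + (f x + P.lam * P.G ^ 2 / 2) := by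
    rw [integral_add hSint' (integrable_const _), integral_div,
      integral_add (integrable_const _) hSint]
    simp
  have hfin' := hfin.trans_eq hcalc
  have hdiv : (10 / P.lam * ‖x₀ - x‖ ^ 2 + ∫ ω, ∑ j ∈ Finset.range P.K, 2 * ((j : ℝ) + 1) *
        (P.η (j + 1) + N j ω) ∂μ) / ((P.K : ℝ) * (P.K + 1)) ≤
      (10 * ‖x₀ - x‖ ^ 2 + 8 * (1 + P.c') * P.Dtilde) / (P.lam * P.K ^ 2) := by
    calc _ ≤ (10 / P.lam * ‖x₀ - x‖ ^ 2 + 8 * (1 + P.c') * P.Dtilde / P.lam)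
          / ((P.K : ℝ) * (P.K + 1)) := by gcongr
      _ ≤ (10 / P.lam * ‖x₀ - x‖ ^ 2 + 8 * (1 + P.c') * P.Dtilde / P.lam)
          / ((P.K : ℝ) * P.K) := by gcongr; linarith
      _ = _ := by field_simp
  linarith

end Guarantee

/-! ### Oracle complexity -/

section Counts

/-- The numbers of outer iterations and of oracle calls, from the inputs alone: `ρ = G * r / ε` is
at least `1`, hence the rounding up in `K`, `That` and `T` costs at most a constant factor. -/
theorem moles_counts_le {c c' a ε r : ℝ} {P : MolesParams} (hc : 0 < c) (hc' : 0 < c') (ha : 0 ≤ a)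
    (hε : 0 < ε) (hG : 0 < P.G) (hr : 0 < r) (hrD : r ≤ P.D) (hlam : P.lam = ε / P.G ^ 2)
    (hDt : P.Dtilde = c * r ^ 2) (hPc : P.c' = c') (hK : P.K = ⌈a * P.G * r / ε⌉₊)
    (hle : ε ≤ P.G * r) :
    (P.K : ℝ) ≤ (a + 1) * (P.G * r / ε) ∧
      (P.K : ℝ) * P.That ≤
        ((a + 1) + 7 * (a + 1) ^ 2 / (c * c')) * (P.G ^ 2 * P.D ^ 2 / ε ^ 2) ∧
      ∑ j ∈ Finset.range P.K, (P.T (j + 1) : ℝ) ≤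
        ((a + 1) + 2 * (a + 1) ^ 4 / c) * ((P.G ^ 2 + P.σ ^ 2) * P.D ^ 2 / ε ^ 2) := by
  have hρ1 : 1 ≤ P.G * r / ε := (one_le_div hε).2 hle
  have hKle : (P.K : ℝ) ≤ (a + 1) * (P.G * r / ε) := by
    have h1 : (P.K : ℝ) < a * P.G * r / ε + 1 := by
      rw [hK]
      exact Nat.ceil_lt_add_one (by positivity)
    have h2 : a * P.G * r / ε = a * (P.G * r / ε) := by ring
    linarith
  have hrD2 : r ^ 2 ≤ P.D ^ 2 := by gcongr
  have hKsq : (P.K : ℝ) ≤ (a + 1) * (P.G ^ 2 * P.D ^ 2 / ε ^ 2) := by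
    refine hKle.trans (mul_le_mul_of_nonneg_left ?_ (by positivity))
    calc P.G * r / ε ≤ P.G * r / ε * (P.G * r / ε) := le_mul_of_one_le_right (by positivity) hρ1
      _ = P.G ^ 2 * r ^ 2 / ε ^ 2 := by field_simp
      _ ≤ _ := by gcongr
  refine ⟨hKle, ?_, ?_⟩
  · have hTh : (P.That : ℝ) ≤ 7 * P.K * P.D ^ 2 / (c' * (c * r ^ 2)) + 1 := by
      have := (Nat.ceil_lt_add_one
        (by positivity : 0 ≤ 7 * P.K * P.D ^ 2 / (c' * (c * r ^ 2)))).le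
      rw [MolesParams.That, hDt, hPc]
      exact this
    calc (P.K : ℝ) * P.That ≤ P.K * (7 * P.K * P.D ^ 2 / (c' * (c * r ^ 2)) + 1) := by gcongr
      _ = 7 * P.K ^ 2 * P.D ^ 2 / (c' * (c * r ^ 2)) + P.K := by ring
      _ ≤ 7 * ((a + 1) * (P.G * r / ε)) ^ 2 * P.D ^ 2 / (c' * (c * r ^ 2))
          + (a + 1) * (P.G ^ 2 * P.D ^ 2 / ε ^ 2) := by gcongr
      _ = _ := by field_simp; ring
  · have hT : ∀ j ∈ Finset.range P.K, (P.T (j + 1) : ℝ) ≤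
        (4 * P.G ^ 2 + P.σ ^ 2) * (ε / P.G ^ 2) ^ 2 * P.K * P.K ^ 2 / (2 * (c * r ^ 2)) + 1 := by
      intro j hj
      have hj' : ((j + 1 : ℕ) : ℝ) ≤ P.K := by exact_mod_cast Finset.mem_range.1 hj
      rw [MolesParams.T, hlam, hDt]
      refine (Nat.ceil_lt_add_one (by positivity)).le.trans ?_
      gcongr
    refine (Finset.sum_le_card_nsmul _ _ _ hT).trans ?_
    rw [Finset.card_range, nsmul_eq_mul]
    calc _ = (4 * P.G ^ 2 + P.σ ^ 2) * (ε / P.G ^ 2) ^ 2 * P.K ^ 4 / (2 * (c * r ^ 2)) + P.K := by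
          ring
      _ ≤ (4 * P.G ^ 2 + 4 * P.σ ^ 2) * (ε / P.G ^ 2) ^ 2 * ((a + 1) * (P.G * r / ε)) ^ 4
          / (2 * (c * r ^ 2)) + (a + 1) * (P.G ^ 2 * P.D ^ 2 / ε ^ 2) := by
          gcongr
          linarith [sq_nonneg P.σ]
      _ = 2 * (a + 1) ^ 4 / c * ((P.G ^ 2 + P.σ ^ 2) * r ^ 2 / ε ^ 2)
          + (a + 1) * (P.G ^ 2 * P.D ^ 2 / ε ^ 2) := by field_simp; ring
      _ ≤ 2 * (a + 1) ^ 4 / c * ((P.G ^ 2 + P.σ ^ 2) * P.D ^ 2 / ε ^ 2)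
          + (a + 1) * ((P.G ^ 2 + P.σ ^ 2) * P.D ^ 2 / ε ^ 2) := by
          gcongr
          linarith [sq_nonneg P.σ]
      _ = _ := by ring

end Counts

/-! ### The guarantee for the prescribed inputs -/

theorem mainTheorem2 (c c' : ℝ) (hc : 0 < c) (hc' : 0 < c') :
    ∃ C : ℝ, 0 < C ∧
      ∀ (d : ℕ) (P : MolesParams) (ε : ℝ) (X : Set (EuclideanSpace ℝ (Fin d)))
        (f : EuclideanSpace ℝ (Fin d) → ℝ)
        (lmo : EuclideanSpace ℝ (Fin d) → EuclideanSpace ℝ (Fin d))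
        (x₀ xstar : EuclideanSpace ℝ (Fin d))
        (Ω : Type*) [MeasurableSpace Ω] (μ : Measure Ω) [IsProbabilityMeasure μ]
        (ghat : ℕ → ℕ → Ω → EuclideanSpace ℝ (Fin d)),
        0 < ε → 0 < P.G → 0 ≤ P.σ →
        -- the constraint set and its linear minimization oracle
        Convex ℝ X → X ⊆ Metric.closedBall 0 P.R →
        IsLMO X lmo → Measurable lmo →
        -- the objective
        ConvexOn ℝ (Metric.closedBall 0 P.R) f →
        (∀ x ∈ Metric.closedBall 0 P.R, ∀ y ∈ Metric.closedBall 0 P.R,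
          |f y - f x| ≤ P.G * ‖y - x‖) →
        x₀ ∈ X → xstar ∈ X → IsMinOn f X xstar →
        -- the choice of the inputs
        P.D = Metric.diam X →
        P.lam = ε / P.G ^ 2 →
        P.Dtilde = c * ‖x₀ - xstar‖ ^ 2 →
        P.c' = c' →
        P.K = ⌈2 * √(10 + 8 * c * (1 + c')) * P.G * ‖x₀ - xstar‖ / ε⌉₊ →
        -- all first-order oracle calls are answered by a stochastic subgradient
        (∀ k < P.K, ∀ t < P.T (k + 1),
          IsSFOAnswer μ f (Metric.closedBall 0 P.R) P.G P.σ
            (fun ω => molesQuery P lmo x₀ (fun i j => ghat i j ω) k t) (ghat (k + 1) t)) →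
        -- the output is feasible and, in expectation, `ε`-suboptimal
        (∀ ω, (moles P lmo x₀ (fun i j => ghat i j ω) P.K).x ∈ X) ∧
        Integrable (fun ω => f (moles P lmo x₀ (fun i j => ghat i j ω) P.K).x) μ ∧
        ∫ ω, f (moles P lmo x₀ (fun i j => ghat i j ω) P.K).x ∂μ - f xstar ≤ ε ∧
        -- the numbers of outer iterations and of oracle calls
        (ε ≤ P.G * ‖x₀ - xstar‖ →
          (P.K : ℝ) ≤ C * (P.G * ‖x₀ - xstar‖ / ε) ∧
          ∀ ω,
            ((moles P lmo x₀ (fun i j => ghat i j ω) P.K).lmoCalls : ℝ) ≤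
              C * (P.G ^ 2 * P.D ^ 2 / ε ^ 2) ∧
            ((moles P lmo x₀ (fun i j => ghat i j ω) P.K).sfoCalls : ℝ) ≤
              C * ((P.G ^ 2 + P.σ ^ 2) * P.D ^ 2 / ε ^ 2)) := by
  obtain ⟨a, ha⟩ : ∃ a, a = 2 * √(10 + 8 * c * (1 + c')) := ⟨_, rfl⟩
  have ha0 : 0 < a := by rw [ha]; positivity
  have ha2 : a ^ 2 = 4 * (10 + 8 * c * (1 + c')) := by
    rw [ha, mul_pow, Real.sq_sqrt (by positivity)]
    norm_num
  refine ⟨(a + 1) + 7 * (a + 1) ^ 2 / (c * c') + 2 * (a + 1) ^ 4 / c, by positivity, ?_⟩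
  intro d P ε X f lmo x₀ xstar Ω _ μ _ ghat hε hG hσ hX hXR hlmo hlmom hf hLip hx₀ hxs hmin hPD
    hlam hDt hPc hK hsfo
  rw [← ha] at hK
  have hfeas := fun ω => (moles_feasible hX hXR hlmo hx₀ (fun i j => ghat i j ω) P.K).1
  have hD : ∀ p ∈ X, ∀ q ∈ X, ‖p - q‖ ≤ P.D := by
    intro p hp q hq
    rw [hPD, ← dist_eq_norm]
    exact Metric.dist_le_diam_of_mem (Metric.isBounded_closedBall.subset hXR) hp hq
  refine ⟨hfeas, ?_⟩
  rcases (norm_nonneg (x₀ - xstar)).eq_or_lt with hr | hr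
  · -- If `x₀` is optimal, then `K = 0` and the output is `x₀`.
    have hx : x₀ = xstar := sub_eq_zero.1 (norm_eq_zero.1 hr.symm)
    have hK0 : P.K = 0 := by
      rw [hK, ← hr]
      simp
    rw [hK0]
    refine ⟨integrable_const (f x₀), ?_, fun h => ?_⟩
    · simp only [moles, hx]
      simpa using hε.le
    · rw [← hr, mul_zero] at h
      exact absurd h (not_le.2 hε)
  have hKpos : 0 < P.K := by
    rw [hK, Nat.ceil_pos]
    positivity
  have hKr : (0 : ℝ) < P.K := by exact_mod_cast hKpos
  obtain ⟨hint, hle⟩ := moles_expected_le hX hXR hlmo hlmom hD hf hLip (by rw [hlam]; positivity)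
    (by rw [hDt]; positivity) (by rw [hPc]; exact hc') hG hKpos hx₀ hxs hsfo
  refine ⟨hint, hle.trans ?_, fun hεr => ?_⟩
  · rw [hlam, hDt, hPc]
    have h1 : a * P.G * ‖x₀ - xstar‖ / ε ≤ P.K := by
      rw [hK]
      exact Nat.le_ceil _
    rw [div_le_iff₀ hε] at h1
    have h2 : (a * P.G * ‖x₀ - xstar‖) ^ 2 ≤ (P.K * ε) ^ 2 := by gcongr
    rw [mul_pow, mul_pow, ha2] at h2
    have h3 : (10 * ‖x₀ - xstar‖ ^ 2 + 8 * (1 + c') * (c * ‖x₀ - xstar‖ ^ 2))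
        / (ε / P.G ^ 2 * P.K ^ 2) ≤ ε / 4 := by
      rw [div_le_iff₀ (by positivity)]
      have h4 : ε / 4 * (ε / P.G ^ 2 * P.K ^ 2) = (P.K * ε) ^ 2 / 4 / P.G ^ 2 := by ring
      rw [h4, le_div_iff₀ (by positivity)]
      linarith
    have h5 : ε / P.G ^ 2 * P.G ^ 2 / 2 = ε / 2 := by field_simp
    linarith
  · obtain ⟨h1, h2, h3⟩ := moles_counts_le hc hc' ha0.le hε hG hr (hD _ hx₀ _ hxs) hlam hDt hPc hK
      hεr
    have h4 : 0 ≤ 7 * (a + 1) ^ 2 / (c * c') := by positivity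
    have h5 : 0 ≤ 2 * (a + 1) ^ 4 / c := by positivity
    refine ⟨h1.trans (mul_le_mul_of_nonneg_right (by linarith) (by positivity)), fun ω => ⟨?_, ?_⟩⟩
    · refine le_trans ?_ (h2.trans (mul_le_mul_of_nonneg_right (by linarith) (by positivity)))
      exact_mod_cast moles_lmoCalls_le P lmo x₀ (fun i j => ghat i j ω) P.K
    · rw [moles_sfoCalls]
      push_cast
      exact h3.trans (mul_le_mul_of_nonneg_right (by linarith) (by positivity))
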